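/- Let $A$ be a two-dimensional regular local ring of prime characteristic $p$ with algebraically closed residue field $k$, $K$ its field of fractions, $L/K$ a cyclic extension of degree $p$, and $B$ the integral closure of $A$ in $L$. For prime ideals $\mathfrak p\ne\mathfrak p'$ of $A$ with $\dim A/\mathfrak p=\dim A/\mathfrak p'=1$ and corresponding prime divisors $F_{\mathfrak p},F_{\mathfrak p'}$ put $(F_{\mathfrak p}.F_{\mathfrak p'})=\dim_k A/(\mathfrak p+\mathfrak p')$ (that is, the length of the $A$-module $A/(\mathfrak p+\mathfrak p')$). Let $\mathfrak p_1,\dots,\mathfrak p_d$ be the distinct primes $\mathfrak p$ of $A$ with $\dim A/\mathfrak p=1$ at which $L/K$ is ramified, and assume that $d\in\{1,2\}$, that all $A/\mathfrak p_i$ are regular and that $(F_{\mathfrak p_1}.F_{\mathfrak p_2})=1$ if $d=2$. Let $v_i$ be the valuation of $K$ associated with $\mathfrak p_i$. Let $U_A$ be the set of primes $\mathfrak p\ne\mathfrak p_1,\dots,\mathfrak p_d$ of $A$ such that $A/\mathfrak p$ is regular of dimension $1$. For $\mathfrak p\in U_A$ let $\mathfrak q$ be any prime of $B$ over $\mathfrak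 p$, let $K(\mathfrak p)$ and $L(\mathfrak q)$ be the fraction fields of $A/\mathfrak p$ and $B/\mathfrak q$, and let $G_{i,\mathfrak p}$ be the lower ramification subgroups of $\mathrm{Gal}(L(\mathfrak q)/K(\mathfrak p))$ with respect to the discrete valuation ring $A/\mathfrak p$. Put $h_{\mathfrak p}=\max\{i : |G_{i,\mathfrak p}|=p\}$ if the ramification index of $L(\mathfrak q)/K(\mathfrak p)$ is $p$, and $h_{\mathfrak p}=0$ otherwise. For $r\ge1$ let $T_r$ be the set of $\mathfrak p\in U_A$ with $(F_{\mathfrak p}.F_{\mathfrak p_1})=r$ and, if $d=2$, also $(F_{\mathfrak p}.F_{\mathfrak p_2})=1$. Then: 1. For every $r\ge1$ there is an integer $s\ge0$ such that $h_{\mathfrak p}=h_{\mathfrak p'}$ whenever $\mathfrak p,\mathfrak p'\in T_r$ are distinct and $(F_{\mathfrak p}.F_{\mathfrak p'})\ge s+1$. Let $\mathrm{su}_{1,r}$ be the minimal such $s$. 2. There is $N\ge1$ such that $\mathrm{su}_{1,r}<Nr$ for all $r\ge1$. 3. If $L=K(x)$ with $x^p-x=a\in K$ and $m_i=-v_i(a)$,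 then for all $r\ge1$ $$\mathrm{su}_{1,r}+1\le\begin{cases}(m_1+1)r+m_2+1,&d=2,\\(m_1+1)r,&d=1;\end{cases}$$ in particular one can take $N=\sum_{i=1}^d(m_i+1)$ in part 2. -/

import Mathlib

noncomputable section

namespace SurfaceRamification

/-- `𝔭` is the generic point of a prime divisor of `Spec A`: a prime ideal with `dim A/𝔭 = 1`. -/
def IsPrimeDivisor {A : Type*} [CommRing A] (𝔭 : Ideal A) : Prop :=
  𝔭.IsPrime ∧ ringKrullDim (A ⧸ 𝔭) = 1

/-- The intersection number `(F_𝔭 . F_𝔭') = dim_k A/(𝔭 + 𝔭')`, where `k` is the residue field of the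
local ring `A`.  It is computed as the length of the `A`-module `A/(𝔭 + 𝔭')`, all of whose simple
subquotients are one-dimensional over `k`; it is `⊤` if `𝔭 = 𝔭'` is a prime divisor. -/
def inter {A : Type*} [CommRing A] (𝔭 𝔭' : Ideal A) : ℕ∞ :=
  Module.length A (A ⧸ (𝔭 ⊔ 𝔭'))

/-- The valuation `v_𝔭 : Kˣ → ℤ` of the fraction field `K` of `A` that belongs to a prime `𝔭` for
which `A_𝔭` is a discrete valuation ring: write `a = f / g` with `f, g ∈ A` and subtract the
orders of vanishing of `f` and `g` in `A_𝔭`. -/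
def primeVal {A : Type*} [CommRing A] {K : Type*} [Field K] [Algebra A K] [IsFractionRing A K]
    (𝔭 : Ideal A) [𝔭.IsPrime] (a : K) : ℤ :=
  ((Ring.ord (Localization.AtPrime 𝔭) (algebraMap A (Localization.AtPrime 𝔭)
      (IsLocalization.sec (nonZeroDivisors A) a).1)).toNat : ℤ)
    - ((Ring.ord (Localization.AtPrime 𝔭) (algebraMap A (Localization.AtPrime 𝔭)
      (IsLocalization.sec (nonZeroDivisors A) a).2.1)).toNat : ℤ)

/-- For a discrete valuation ring `R` and a finite Galois extension `E` of its field of fractions,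
with integral closure `C` of `R` in `E`, and for a maximal ideal `P` of `C`: the `i`-th lower
ramification group `G_i` of `P`, i.e. the group of those `σ` in the Galois group of `E` over the
field of fractions of `R` (that is, of the automorphisms of the `R`-algebra `E`)
that act trivially on `C / P ^ (i + 1)`. -/
def lowerGroup (R : Type*) [CommRing R] {E : Type*} [Field E] [Algebra R E]
    (P : Ideal (integralClosure R E)) (i : ℕ) : Subgroup (E ≃ₐ[R] E) :=
  (P ^ (i + 1)).toAddSubgroup.inertia (E ≃ₐ[R] E)

/-- `R` and `E` as above, with `E` of degree `p` or `1` over the fraction field of `R`.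
If the ramification index of `E` over `R` is `p` (so that `P` below is unique), this is
`max {i | |G_i| = p}`; otherwise the set below is empty and the value is `0`. -/
def ramJump (p : ℕ) (R : Type*) [CommRing R] (E : Type*) [Field E] [Algebra R E] : ℕ :=
  sSup {i : ℕ | ∃ P : Ideal (integralClosure R E), P.IsMaximal ∧ P.ramificationIdx R = p ∧
    Nat.card (lowerGroup R P i) = p}

section

variable (A : Type*) [CommRing A] (L : Type*) [Field L] [Algebra A L]

/-- The jump `h_𝔭(L/K)`, where `𝔭 = 𝔮 ∩ A` for the given prime ideal `𝔮` of the integral closure `B`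
of `A` in `L`: the ramification jump of the extension `L(𝔮) / K(𝔭)`, where `L(𝔮)` and `K(𝔭)` are the
fraction fields of `B/𝔮` and of the discrete valuation ring `A/𝔭`. -/
def jump (p : ℕ) (𝔮 : Ideal (integralClosure A L)) [𝔮.IsPrime] : ℕ :=
  ramJump p (A ⧸ 𝔮.under A) (FractionRing (integralClosure A L ⧸ 𝔮))

/-- The components of the branch divisor: the prime divisors of `A` over which some prime of the
integral closure of `A` in `L` is ramified. -/
def branchPrimes : Set (Ideal A) :=
  {𝔭 | IsPrimeDivisor 𝔭 ∧ ∃ (𝔮 : Ideal (integralClosure A L)) (_ : 𝔮.IsPrime),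
    𝔮.under A = 𝔭 ∧ ¬ Algebra.IsUnramifiedAt A 𝔮}

end

/-- The set `T_r`: regular prime divisors, distinct from all the `F_{𝔟 i}`, whose intersection
number with the first `F_{𝔟 i}` is `r`, and with the others (there is at most one) is `1`. -/
def jetSet {A : Type*} [CommRing A] {d : ℕ} (𝔟 : Fin d → Ideal A) (r : ℕ) : Set (Ideal A) :=
  {𝔭 | IsPrimeDivisor 𝔭 ∧ IsRegularLocalRing (A ⧸ 𝔭) ∧ (∀ i, 𝔭 ≠ 𝔟 i) ∧
    ∀ i, inter 𝔭 (𝔟 i) = if (i : ℕ) = 0 then (r : ℕ∞) else 1}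

/-- `s` is a sufficient jet order for `T_r`: `h_𝔭 = h_𝔭'` whenever `𝔭, 𝔭' ∈ T_r` and
`(F_𝔭 . F_𝔭') ≥ s + 1`.  Here `h_𝔭` and `h_𝔭'` may be computed with any
primes `𝔮` and `𝔮'` over `𝔭` and `𝔭'`. -/
def IsSufficientOrder {A : Type*} [CommRing A] (L : Type*) [Field L] [Algebra A L] (p : ℕ)
    {d : ℕ} (𝔟 : Fin d → Ideal A) (r s : ℕ) : Prop :=
  ∀ 𝔭 ∈ jetSet 𝔟 r, ∀ 𝔭' ∈ jetSet 𝔟 r, (s : ℕ∞) + 1 ≤ inter 𝔭 𝔭' →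
    ∀ (𝔮 𝔮' : Ideal (integralClosure A L)) [𝔮.IsPrime] [𝔮'.IsPrime],
      𝔮.under A = 𝔭 → 𝔮'.under A = 𝔭' → jump A L p 𝔮 = jump A L p 𝔮'

/-- The minimal sufficient jet order `su_{1,r}(L/K)`. -/
def su {A : Type*} [CommRing A] (L : Type*) [Field L] [Algebra A L] (p : ℕ)
    {d : ℕ} (𝔟 : Fin d → Ideal A) (r : ℕ) : ℕ :=
  sInf {s : ℕ | IsSufficientOrder L p 𝔟 r s}

end SurfaceRamification

end

/-! ### Prime divisors of a two-dimensional regular local ring. -/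

namespace SurfaceRamification

open IsLocalRing

/-! Additive Hilbert 90 gives `L = K(x)` with `x ^ p - x = a`, and `x` may be replaced by `x + G`,
which replaces `a` by `a + G ^ p - G`. The proof has two halves: normalise `a` on the surface, then
read the jump along a curve off the restriction of the normalised equation.

Normalisation. `A` is factorial, so poles can be treated one prime element `h` at a time. If `L/K`
is unramified along `h` and `a` has a pole there, its order is `p * k` and its leading coefficient
is a `p`-th power in the residue field (`exists_pow_of_isUnramifiedAt`). Subtracting a suitable `γ ^
p - γ` lowers the pole, and the denominator of `γ` can be taken to be `h ^ k` times a power of the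
product `T` of the branch primes (`exists_mul_pow_eq_algebraMap`). All poles off the branch divisor
disappear, but those on it may have grown. They are brought back to the original orders `m i` by the
same kind of subtraction, which is possible without spoiling the other component because the second
parameter is a uniformizer on the first curve (`exists_reduce_pole`).

Restriction. On a curve `P` of `T_r` let `π` be a uniformizer, `ρ i` the intersection number with
the `i`-th branch curve, and `M = ∑ m i * ρ i`. The residue of `x` generates the residue extension
and satisfies `y ^ p - y = e / π ^ M`. Over a discrete valuation ring with perfect residue field the
jump is the least pole order in the class of `e / π ^ M` modulo the elements `g ^ p - g`
(`ramJump_eq_sInf`), so it depends only on `e` modulo `P + (π ^ M)` (`jump_eq_sInf`). Two curves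
that meet to order `X = ∑ (m i + 1) * ρ i` share this ideal. Writing the branch equations as `π ^ ρ
i` times units costs up to `ρ i` orders of precision, and `M + ρ i ≤ X` leaves enough to make the
two elements `e` congruent (`isSufficientOrder_sum`). Hence `X - 1` is a sufficient order, and all
three assertions follow. -/

/-- In a Noetherian local domain whose maximal ideal is generated by `x` and `y`, a nonzero prime
ideal which does not contain `x` is principal. -/
theorem isPrincipal_of_notMem {A : Type*} [CommRing A] [IsLocalRing A] [IsNoetherianRing A]
    {x y : A} (hm : maximalIdeal A = Ideal.span {x, y}) {q : Ideal A} [q.IsPrime]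
    (hxq : x ∉ q) : ∃ f, q = Ideal.span {f} := by
  have hxm : x ∈ maximalIdeal A := hm ▸ Ideal.subset_span (by simp)
  -- As `q` is prime and omits `x`, a multiple `x * c` lying in `q` has `c ∈ q`. The inclusion thus
  -- improves to `q ≤ (f) + x q`, and Nakayama applies.
  have key : ∀ f ∈ q, q ≤ Ideal.span {f} ⊔ Ideal.span {x} → q = Ideal.span {f} := by
    intro f hf hle
    refine le_antisymm ?_ ((Ideal.span_singleton_le_iff_mem _).2 hf)
    refine Submodule.le_of_le_smul_of_le_jacobson_bot (I := Ideal.span {x})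
      (IsNoetherian.noetherian q) ?_ ?_
    · rw [jacobson_eq_maximalIdeal _ bot_ne_top]
      exact (Ideal.span_singleton_le_iff_mem _).2 hxm
    · intro g hg
      obtain ⟨u, hu, v, hv, huv⟩ := Submodule.mem_sup.1 (hle hg)
      obtain ⟨c, rfl⟩ := Ideal.mem_span_singleton.1 hv
      have huq : u ∈ q := (Ideal.span_singleton_le_iff_mem _).2 hf hu
      have : x * c ∈ q := by
        have := q.sub_mem hg huq
        rwa [← huv, add_sub_cancel_left] at this
      have hc : c ∈ q := (Ideal.IsPrime.mem_or_mem ‹_› this).resolve_left hxq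
      exact huv ▸ Submodule.add_mem_sup hu
        (Submodule.smul_mem_smul (Ideal.mem_span_singleton_self x) hc)
  by_cases hqx : q ≤ Ideal.span {x}
  · exact ⟨0, key 0 q.zero_mem (hqx.trans le_sup_right)⟩
  have hym : y ∈ maximalIdeal A := hm ▸ Ideal.subset_span (by simp)
  -- Modulo `x` the maximal ideal is generated by `y`, so by Krull's intersection theorem every
  -- nonzero residue is a unit times a power of `y`.
  have hpow : ∀ g ∉ Ideal.span {x}, ∃ n : ℕ, g ∈ Ideal.span {y ^ n} ⊔ Ideal.span {x} ∧
      y ^ n ∈ Ideal.span {g} ⊔ Ideal.span {x} := by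
    intro g hg
    have hxt : Ideal.span {x} ≠ ⊤ := ne_top_of_le_ne_top (maximalIdeal.isMaximal A).ne_top
      ((Ideal.span_singleton_le_iff_mem _).2 hxm)
    have : Nontrivial (A ⧸ Ideal.span {x}) := Ideal.Quotient.nontrivial_iff.2 hxt
    have : IsLocalRing (A ⧸ Ideal.span {x}) :=
      .of_surjective' (Ideal.Quotient.mk _) Ideal.Quotient.mk_surjective
    set π := Ideal.Quotient.mk (Ideal.span {x})
    have hyt : Ideal.span {π y} ≠ ⊤ := by
      rw [Ne, Ideal.span_singleton_eq_top]
      intro hu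
      exact (mem_maximalIdeal y).1 hym
        ((IsLocalHom.of_surjective π Ideal.Quotient.mk_surjective).map_nonunit y hu)
    have hex : ∃ k, π g ∉ Ideal.span {π y} ^ k := by
      by_contra! hall
      apply hg
      have : π g ∈ (⨅ i, Ideal.span {π y} ^ i : Ideal _) := by simpa [Ideal.mem_iInf] using hall
      rw [Ideal.iInf_pow_eq_bot_of_isLocalRing _ hyt] at this
      exact Ideal.Quotient.eq_zero_iff_mem.1 this
    classical
    obtain ⟨n, hn⟩ : ∃ n, Nat.find hex = n + 1 := Nat.exists_eq_succ_of_ne_zero fun h0 => by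
      simpa [h0] using Nat.find_spec hex
    have hin : π g ∈ Ideal.span {π y} ^ n := not_not.1 (Nat.find_min hex (by omega))
    have hout : π g ∉ Ideal.span {π y} ^ (n + 1) := hn ▸ Nat.find_spec hex
    rw [Ideal.span_singleton_pow] at hin hout
    obtain ⟨u, hu⟩ := Ideal.mem_span_singleton.1 hin
    obtain ⟨u, rfl⟩ := Ideal.Quotient.mk_surjective u
    have huu : IsUnit u := by
      by_contra hnu
      have : u ∈ Ideal.span {x, y} := hm ▸ (mem_maximalIdeal u).2 hnu
      obtain ⟨b, c, rfl⟩ := Ideal.mem_span_pair.1 this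
      apply hout
      rw [hu, Ideal.mem_span_singleton]
      have hx0 : π x = 0 := Ideal.Quotient.eq_zero_iff_mem.2 (Ideal.mem_span_singleton_self x)
      exact ⟨π c, by simp only [π, map_add, map_mul] at hx0 ⊢; rw [hx0]; ring⟩
    have hgu : g - y ^ n * u ∈ Ideal.span {x} := by
      rw [← Ideal.Quotient.eq_zero_iff_mem, map_sub, map_mul, map_pow]
      exact sub_eq_zero.2 hu
    obtain ⟨c, hc⟩ := Ideal.mem_span_singleton.1 hgu
    obtain ⟨v, hv⟩ := huu.exists_right_inv
    refine ⟨n, ?_, ?_⟩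
    · rw [← sub_add_cancel g (y ^ n * u), hc, add_comm]
      exact Submodule.add_mem_sup (Ideal.mem_span_singleton.2 ⟨u, rfl⟩)
        (Ideal.mem_span_singleton.2 ⟨c, rfl⟩)
    · have : y ^ n = g * v + x * (-c * v) := by
        linear_combination (-v) * hc - y ^ n * hv
      rw [this]
      exact Submodule.add_mem_sup (Ideal.mem_span_singleton.2 ⟨v, rfl⟩)
        (Ideal.mem_span_singleton.2 ⟨_, rfl⟩)
  obtain ⟨g₁, hg₁, hg₁x⟩ := SetLike.not_le_iff_exists.1 hqx
  have hex : ∃ n : ℕ, ∃ g ∈ q, g ∉ Ideal.span {x} ∧ y ^ n ∈ Ideal.span {g} ⊔ Ideal.span {x} := by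
    obtain ⟨n, -, hn⟩ := hpow g₁ hg₁x
    exact ⟨n, g₁, hg₁, hg₁x, hn⟩
  classical
  -- An element of `q` with least `y`-order modulo `x` generates `q` modulo `x`.
  obtain ⟨g₀, hg₀, hg₀x, hy⟩ := Nat.find_spec hex
  refine ⟨g₀, key g₀ hg₀ fun g hg => ?_⟩
  by_cases hgx : g ∈ Ideal.span {x}
  · exact Submodule.mem_sup_right hgx
  obtain ⟨n, h1, h2⟩ := hpow g hgx
  have hle : Nat.find hex ≤ n := Nat.find_min' hex ⟨g, hg, hgx, h2⟩
  have hy' : y ^ n ∈ Ideal.span {g₀} ⊔ Ideal.span {x} := Ideal.pow_mem_of_pow_mem _ hy hle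
  exact (sup_le ((Ideal.span_singleton_le_iff_mem _).2 hy') le_sup_right) h1

section Surface

variable {A : Type*} [CommRing A] [IsRegularLocalRing A]

theorem exists_maximalIdeal_eq_span_pair (hdim : ringKrullDim A = 2) :
    ∃ x y : A, maximalIdeal A = Ideal.span {x, y} := by
  have h := IsRegularLocalRing.spanFinrank_maximalIdeal (R := A)
  rw [hdim] at h
  have h2 : (maximalIdeal A).spanFinrank = 2 := by exact_mod_cast h
  have hfg : Submodule.FG (maximalIdeal A) := IsNoetherian.noetherian _
  rw [← Submodule.FG.generators_ncard hfg, Set.ncard_eq_two] at h2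
  obtain ⟨x, y, -, hxy⟩ := h2
  exact ⟨x, y, by rw [← hxy]; exact (Submodule.span_generators _).symm⟩

/-- A prime other than the maximal ideal omits one of the two generators of that ideal, and they
play symmetric roles in `isPrincipal_of_notMem`. -/
theorem exists_eq_span_prime (hdim : ringKrullDim A = 2) {q : Ideal A} [q.IsPrime] (hq : q ≠ ⊥)
    (hqm : q ≠ maximalIdeal A) : ∃ f, Prime f ∧ q = Ideal.span {f} := by
  obtain ⟨x, y, hm⟩ := exists_maximalIdeal_eq_span_pair hdim
  have : ∃ f, q = Ideal.span {f} := by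
    by_cases hx : x ∈ q
    · refine isPrincipal_of_notMem (x := y) (y := x) (by rw [hm, Set.pair_comm]) fun hy => hqm ?_
      refine le_antisymm (le_maximalIdeal Ideal.IsPrime.ne_top') ?_
      rw [hm, Ideal.span_le]
      rintro z (rfl | rfl) <;> assumption
    · exact isPrincipal_of_notMem hm hx
  obtain ⟨f, rfl⟩ := this
  exact ⟨f, (Ideal.span_singleton_prime (by rintro rfl; simp at hq)).1 inferInstance, rfl⟩

theorem IsPrimeDivisor.exists_eq_span (hdim : ringKrullDim A = 2) {q : Ideal A}
    (hq : IsPrimeDivisor q) : ∃ f, Prime f ∧ q = Ideal.span {f} := by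
  obtain ⟨hp, h1⟩ := hq
  refine exists_eq_span_prime hdim ?_ ?_
  · rintro rfl
    rw [ringKrullDim_eq_of_ringEquiv (RingEquiv.quotientBot A), hdim] at h1
    exact absurd h1 (by decide)
  · rintro rfl
    have : IsField (A ⧸ maximalIdeal A) :=
      (Ideal.Quotient.maximal_ideal_iff_isField_quotient _).1 inferInstance
    rw [ringKrullDim_eq_zero_of_isField this] at h1
    exact absurd h1 (by decide)

variable [IsDomain A]

/-- Kaplansky's criterion: a minimal prime over a nonzero element of `I` has height at most one by
Krull's theorem, so it is not the maximal ideal and is generated by a prime element. -/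
theorem uniqueFactorizationMonoid (hdim : ringKrullDim A = 2) : UniqueFactorizationMonoid A := by
  rw [UniqueFactorizationMonoid.iff_exists_prime_mem_of_isPrime]
  intro I hI hIp
  obtain ⟨f, hf, hf0⟩ := Submodule.exists_mem_ne_zero_of_ne_bot hI
  obtain ⟨q, hq, hqI⟩ := Ideal.exists_minimalPrimes_le ((Ideal.span_singleton_le_iff_mem I).2 hf)
  have : q.IsPrime := hq.1.1
  have hfq : f ∈ q := hq.1.2 (Ideal.mem_span_singleton_self f)
  have hht := Ideal.height_le_one_of_isPrincipal_of_mem_minimalPrimes _ q hq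
  obtain ⟨g, hg, rfl⟩ := exists_eq_span_prime hdim (q := q) (by rintro rfl; exact hf0 hfq) (by
    rintro rfl
    have h := IsLocalRing.maximalIdeal_height_eq_ringKrullDim (R := A)
    rw [hdim] at h
    have h' : (maximalIdeal A).height = 2 := WithBot.coe_injective h
    rw [h'] at hht
    exact absurd hht (by decide))
  exact ⟨g, hqI (Ideal.mem_span_singleton_self g), hg⟩

theorem isPrimeDivisor_span (hdim : ringKrullDim A = 2) {f : A} (hf : Prime f) :
    IsPrimeDivisor (Ideal.span {f}) := by
  refine ⟨(Ideal.span_singleton_prime hf.ne_zero).2 hf, ?_⟩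
  have := ringKrullDim_quotient_span_singleton_succ_eq_ringKrullDim_of_mem_nonZeroDivisors
    (mem_nonZeroDivisors_of_ne_zero hf.ne_zero) ((mem_maximalIdeal f).2 hf.not_isUnit)
  rw [hdim] at this
  refine ENat.WithBot.add_natCast_cancel (c := 1).1 ?_
  rw [Nat.cast_one, this]
  rfl

/-- The only prime containing both `h` and `γ` is the maximal ideal, so `T` lies in the radical of
`(h, γ)`. Consequently every fraction on the curve `h = 0` can be written with a power of `T` as
denominator. -/
theorem exists_dvd_pow_sub_mul (hdim : ringKrullDim A = 2) {h T γ : A} (hh : Prime h)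
    (hT : ¬ IsUnit T) (hγ : ¬ h ∣ γ) : ∃ (M : ℕ) (s : A), h ∣ T ^ M - γ * s := by
  have : T ∈ (Ideal.span {h, γ}).radical := by
    rw [Ideal.radical_eq_sInf, Ideal.mem_sInf]
    rintro Q ⟨hQ, hQp⟩
    by_contra hTQ
    have hhQ : h ∈ Q := hQ (Ideal.subset_span (by simp))
    obtain ⟨f, hf, rfl⟩ := exists_eq_span_prime hdim (q := Q)
      (by rintro rfl; exact hh.ne_zero hhQ)
      (by rintro rfl; exact hTQ ((mem_maximalIdeal T).2 hT))
    have hfh := hf.dvd_prime_iff_associated hh |>.1 (Ideal.mem_span_singleton.1 hhQ)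
    refine hγ (hfh.dvd_iff_dvd_left.1 (Ideal.mem_span_singleton.1 (hQ (Ideal.subset_span ?_))))
    simp
  obtain ⟨M, hM⟩ := this
  obtain ⟨b, c, hbc⟩ := Ideal.mem_span_pair.1 hM
  exact ⟨M, c, b, by rw [← hbc]; ring⟩

end Surface

theorem isDiscreteValuationRing_of_isRegularLocalRing {R : Type*} [CommRing R] [IsDomain R]
    [IsRegularLocalRing R] (hdim : ringKrullDim R = 1) : IsDiscreteValuationRing R := by
  have hF : ¬ IsField R := fun h => by
    rw [ringKrullDim_eq_zero_of_isField h] at hdim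
    exact absurd hdim (by decide)
  refine ((IsDiscreteValuationRing.TFAE R hF).out 4 0 :).1 ?_
  have h := IsRegularLocalRing.spanFinrank_maximalIdeal (R := R)
  rw [hdim] at h
  have h2 : (maximalIdeal R).spanFinrank = 1 := by exact_mod_cast h
  have hfg : Submodule.FG (maximalIdeal R) := IsNoetherian.noetherian _
  rw [← Submodule.FG.generators_ncard hfg, Set.ncard_eq_one] at h2
  obtain ⟨x, hx⟩ := h2
  exact ⟨x, by rw [← hx]; exact (Submodule.span_generators _).symm⟩

/-- Turns intersection numbers into orders of vanishing on the curve; the length may be taken over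
`A` or `A ⧸ q` because the quotient map is surjective. -/
theorem inter_span_singleton {A : Type*} [CommRing A] (q : Ideal A) (t : A) :
    inter q (Ideal.span {t}) = Ring.ord (A ⧸ q) (Ideal.Quotient.mk q t) := by
  have e : ((A ⧸ q) ⧸ Ideal.span {Ideal.Quotient.mk q t}) ≃ₗ[A] A ⧸ q ⊔ Ideal.span {t} :=
    (Ideal.quotientEquivAlgOfEq A (by rw [Ideal.map_span, Set.image_singleton]; rfl)).toLinearEquiv.trans
      (DoubleQuot.quotQuotEquivQuotSupₐ A q (Ideal.span {t})).toLinearEquiv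
  rw [inter, Ring.ord, ← e.length_eq]
  exact Module.length_eq_of_surjective Ideal.Quotient.mk_surjective

end SurfaceRamification

/-! ### Artin-Schreier orders and unramifiedness away from the poles. -/

namespace SurfaceRamification

open Polynomial

theorem monic_X_pow_sub_C_mul_X_sub_C {A : Type*} [CommRing A] {p : ℕ} (hp : 1 < p) (c e : A) :
    (X ^ p - C c * X - C e).Monic := by
  rw [sub_sub]
  refine monic_X_pow_sub ?_
  refine (degree_add_le _ _).trans_lt (max_lt ?_ ?_)
  · refine (degree_C_mul_X_le c).trans_lt ?_
    exact_mod_cast hp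
  · refine degree_C_le.trans_lt ?_
    exact_mod_cast zero_lt_one.trans hp

theorem natDegree_X_pow_sub_C_mul_X_sub_C {A : Type*} [CommRing A] [Nontrivial A] {p : ℕ}
    (hp : 1 < p) (c e : A) : (X ^ p - C c * X - C e).natDegree = p := by
  have h1 : (C c * X + C e : A[X]).natDegree < (X ^ p : A[X]).natDegree := by
    rw [natDegree_X_pow]
    exact natDegree_linear_le.trans_lt hp
  rw [sub_sub, natDegree_sub_eq_left_of_natDegree_lt h1, natDegree_X_pow]

theorem isIntegral_of_pow_sub_mul_eq {A L : Type*} [CommRing A] [CommRing L] [Algebra A L] {p : ℕ}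
    (hp : 1 < p) {c e : A} {y : L} (h : y ^ p - algebraMap A L c * y = algebraMap A L e) :
    IsIntegral A y := by
  refine ⟨_, monic_X_pow_sub_C_mul_X_sub_C hp c e, ?_⟩
  rw [← aeval_def]
  simp only [map_sub, map_mul, aeval_X, aeval_C, map_pow]
  rw [h, sub_self]

/-- Clearing the denominator of an Artin-Schreier equation. -/
theorem mul_pow_sub_pow_mul_mul {A L : Type*} [CommRing A] [CommRing L] [Algebra A L] {p : ℕ}
    (hp : 0 < p) {f g : A} {x : L} (h : (x ^ p - x) * algebraMap A L g = algebraMap A L f) :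
    (algebraMap A L g * x) ^ p - algebraMap A L (g ^ (p - 1)) * (algebraMap A L g * x) =
      algebraMap A L (g ^ (p - 1) * f) := by
  obtain ⟨k, rfl⟩ : ∃ k, p = k + 1 := ⟨p - 1, by omega⟩
  simp only [map_pow, map_mul, Nat.add_sub_cancel, ← h]
  ring

section ArtinSchreierOrder

variable {A K L : Type*} [CommRing A] [Field K] [Algebra A K]
  [Field L] [Algebra K L] [Algebra A L] [IsScalarTower A K L]

/-- If `L = K(y)` has degree `p` and `y ^ p - c y = e` with `c, e ∈ A`, the discriminant of `A[y]`
is `± c ^ p`, so that `c ^ p` multiplies the integral closure of `A` into `A[y]`. -/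
theorem pow_mul_mem_adjoin [IsDomain A] [IsIntegrallyClosed A] [IsFractionRing A K]
    [FiniteDimensional K L] [Algebra.IsSeparable K L] {p : ℕ} [Fact p.Prime] [CharP A p]
    (hdeg : Module.finrank K L = p) {y : L} (hy : IntermediateField.adjoin K {y} = ⊤) {c e : A}
    (h : y ^ p - algebraMap A L c * y = algebraMap A L e) {b : L} (hb : IsIntegral A b) :
    algebraMap A L (c ^ p) * b ∈ Algebra.adjoin A {y} := by
  have hp := (Fact.out : p.Prime)
  have : CharP K p := charP_of_injective_algebraMap (IsFractionRing.injective A K) p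
  have : CharP L p := charP_of_injective_algebraMap (algebraMap K L).injective p
  set P : A[X] := X ^ p - C c * X - C e with hP
  have hPm : P.Monic := monic_X_pow_sub_C_mul_X_sub_C hp.one_lt c e
  have hPd : P.natDegree = p := natDegree_X_pow_sub_C_mul_X_sub_C hp.one_lt c e
  have hPy : aeval y P = 0 := by
    simp only [hP, map_sub, map_mul, aeval_X, aeval_C, map_pow]
    rw [h, sub_self]
  have hint : IsIntegral A y := ⟨P, hPm, hPy⟩
  have hintK : IsIntegral K y := hint.tower_top
  have hmin : P.map (algebraMap A K) = minpoly K y := by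
    refine eq_of_monic_of_dvd_of_natDegree_le (minpoly.monic hintK) (hPm.map _)
      (minpoly.dvd K y (by rw [aeval_map_algebraMap, hPy])) ?_
    rw [hPm.natDegree_map, hPd, ← hdeg,
      (Field.primitive_element_iff_minpoly_natDegree_eq K y).1 hy]
  have hadj : Algebra.adjoin K {y} = ⊤ :=
    (IntermediateField.adjoin_simple_eq_top_iff_of_isAlgebraic hintK.isAlgebraic).1 hy
  set B := PowerBasis.ofAdjoinEqTop hintK hadj
  have hgen : B.gen = y := PowerBasis.ofAdjoinEqTop_gen _ _
  have hder : aeval y (minpoly K y).derivative = algebraMap K L (algebraMap A K (-c)) := by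
    have hd : derivative P = C (-c) := by
      rw [hP, derivative_sub, derivative_sub, derivative_X_pow, CharP.cast_eq_zero]
      simp
    rw [← hmin, derivative_map, aeval_map_algebraMap, hd, aeval_C,
      ← IsScalarTower.algebraMap_apply]
  have hdisc : Algebra.discr K B.basis =
      algebraMap A K ((-1) ^ (p * (p - 1) / 2) * (-c) ^ p) := by
    rw [Algebra.discr_powerBasis_eq_norm, hgen, hder, Algebra.norm_algebraMap, hdeg]
    simp
  have key := Algebra.discr_mul_isIntegral_mem_adjoin K (B := B) (hgen ▸ hint) hb
  rw [hgen, hdisc, algebraMap_smul] at key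
  have hcp : c ^ p = ((-1) ^ (p * (p - 1) / 2) * (-1) ^ p) *
      ((-1) ^ (p * (p - 1) / 2) * (-c) ^ p) := by
    have : ((-1 : A) ^ (p * (p - 1) / 2)) * (-1) ^ (p * (p - 1) / 2) = 1 := by
      rw [← mul_pow]; simp
    rw [neg_pow c]
    have h2 : ((-1 : A) ^ p) * (-1) ^ p = 1 := by
      rw [← mul_pow]; simp
    linear_combination (-(c ^ p)) * this * (-1 : A) ^ p * (-1) ^ p - c ^ p * h2
  rw [← Algebra.smul_def, hcp, mul_smul]
  exact Subalgebra.smul_mem _ key _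

theorem adjoin_algebraMap_mul_eq_top [IsFractionRing A K] {x : L}
    (hx : IntermediateField.adjoin K {x} = ⊤) {g : A} (hg0 : g ≠ 0) :
    IntermediateField.adjoin K {algebraMap A L g * x} = ⊤ := by
  set y := algebraMap A L g * x
  rw [eq_top_iff, ← hx, IntermediateField.adjoin_simple_le_iff]
  have h1 : algebraMap K L (algebraMap A K g) * x ∈ IntermediateField.adjoin K {y} := by
    rw [← IsScalarTower.algebraMap_apply]
    exact IntermediateField.mem_adjoin_simple_self K y
  have h2 := IntermediateField.mul_mem _ (IntermediateField.algebraMap_mem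
    (IntermediateField.adjoin K {y}) (algebraMap A K g)⁻¹) h1
  rwa [← mul_assoc, ← map_mul, inv_mul_cancel₀, map_one, one_mul] at h2
  exact fun h0 => hg0 (IsFractionRing.injective A K (by rw [h0, map_zero]))

/-- The universal derivation `D` is shown to vanish. It kills `y = g * x` because differentiating
the equation in characteristic `p` leaves only `g ^ (p - 1) * D y = 0` with `g` invertible. It then
kills all of the integral closure, since a power of `g` carries that into `A[y]`. -/
theorem formallyUnramified_of_artinSchreier [IsDomain A] [IsIntegrallyClosed A] [IsFractionRing A K]
    [FiniteDimensional K L] [Algebra.IsSeparable K L] {p : ℕ} [Fact p.Prime] [CharP A p]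
    (hdeg : Module.finrank K L = p) {x : L} (hx : IntermediateField.adjoin K {x} = ⊤) {f g : A}
    (h : (x ^ p - x) * algebraMap A L g = algebraMap A L f)
    (q : Ideal (integralClosure A L)) [q.IsPrime] (hg : g ∉ q.under A)
    (S : Type*) [CommRing S] [Algebra A S] [Algebra (integralClosure A L) S]
    [IsScalarTower A (integralClosure A L) S] [IsLocalization.AtPrime S q] :
    Algebra.FormallyUnramified A S := by
  have hp := (Fact.out : p.Prime)
  have hg0 : g ≠ 0 := by rintro rfl; exact hg (Ideal.zero_mem _)
  have hgu : IsUnit (algebraMap A S g) := by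
    rw [IsScalarTower.algebraMap_apply A (integralClosure A L) S]
    exact (IsLocalization.AtPrime.isUnit_to_map_iff S q _).2 hg
  set y : L := algebraMap A L g * x
  have hyp : y ^ p - algebraMap A L (g ^ (p - 1)) * y = algebraMap A L (g ^ (p - 1) * f) :=
    mul_pow_sub_pow_mul_mul hp.pos h
  have hyi : IsIntegral A y := isIntegral_of_pow_sub_mul_eq hp.one_lt hyp
  have hyK : IntermediateField.adjoin K {y} = ⊤ := adjoin_algebraMap_mul_eq_top hx hg0
  set D := KaehlerDifferential.D A S
  have hchar : (p : S) = 0 := by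
    rw [← map_natCast (algebraMap A S), CharP.cast_eq_zero, map_zero]
  set Y : integralClosure A L := ⟨y, hyi⟩
  have hDA : ∀ r : A, D (algebraMap A S r) = 0 := D.map_algebraMap
  have hDY : D (algebraMap _ S Y) = 0 := by
    have hYeq : Y ^ p - algebraMap A _ (g ^ (p - 1)) * Y = algebraMap A _ (g ^ (p - 1) * f) :=
      Subtype.ext hyp
    have h1 := congrArg D (congrArg (algebraMap _ S) hYeq)
    rw [← IsScalarTower.algebraMap_apply, hDA, map_sub, map_sub, map_mul, map_pow,
      D.leibniz_pow, D.leibniz, ← IsScalarTower.algebraMap_apply, hDA, smul_zero, add_zero,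
      ← Nat.cast_smul_eq_nsmul S, hchar, zero_smul, zero_sub, neg_eq_zero] at h1
    rw [map_pow] at h1
    exact (IsUnit.smul_eq_zero (hgu.pow (p - 1))).1 h1
  have hDB : ∀ b : integralClosure A L, D (algebraMap _ S b) = 0 := by
    intro b
    have hmem := pow_mul_mem_adjoin hdeg hyK hyp b.2
    have hz : ∀ z ∈ Algebra.adjoin A {y}, ∃ hz : IsIntegral A z,
        D (algebraMap (integralClosure A L) S ⟨z, hz⟩) = 0 := by
      intro z hz
      induction hz using Algebra.adjoin_induction with
      | mem z hz =>
        obtain rfl := hz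
        exact ⟨hyi, hDY⟩
      | algebraMap r =>
        refine ⟨isIntegral_algebraMap, ?_⟩
        have := hDA r
        rwa [IsScalarTower.algebraMap_apply A (integralClosure A L) S] at this
      | add z w _ _ hz hw =>
        obtain ⟨hz, hz'⟩ := hz
        obtain ⟨hw, hw'⟩ := hw
        refine ⟨hz.add hw, ?_⟩
        have : (⟨z + w, hz.add hw⟩ : integralClosure A L) = ⟨z, hz⟩ + ⟨w, hw⟩ := rfl
        rw [this, map_add, map_add, hz', hw', add_zero]
      | mul z w _ _ hz hw =>
        obtain ⟨hz, hz'⟩ := hz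
        obtain ⟨hw, hw'⟩ := hw
        refine ⟨hz.mul hw, ?_⟩
        have : (⟨z * w, hz.mul hw⟩ : integralClosure A L) = ⟨z, hz⟩ * ⟨w, hw⟩ := rfl
        rw [this, map_mul, D.leibniz, hz', hw', smul_zero, smul_zero, add_zero]
    obtain ⟨hzi, hz0⟩ := hz _ hmem
    have : (⟨_, hzi⟩ : integralClosure A L) = algebraMap A _ ((g ^ (p - 1)) ^ p) * b := rfl
    rw [this, map_mul, D.leibniz, ← IsScalarTower.algebraMap_apply, hDA, smul_zero, add_zero,
      map_pow, map_pow] at hz0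
    exact (IsUnit.smul_eq_zero ((hgu.pow (p - 1)).pow p)).1 hz0
  have hD : ∀ s : S, D s = 0 := by
    intro s
    obtain ⟨⟨b, u⟩, hs⟩ := IsLocalization.surj q.primeCompl s
    have h1 := congrArg D hs
    simp only [hDB, D.leibniz, smul_zero, zero_add] at h1
    exact (IsUnit.smul_eq_zero (IsLocalization.map_units S u)).1 h1
  constructor
  have hspan := KaehlerDifferential.span_range_derivation A S
  refine (Submodule.subsingleton_iff S).1 (subsingleton_of_bot_eq_top ?_)
  rw [← hspan, eq_comm, Submodule.span_eq_bot]
  rintro _ ⟨s, rfl⟩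
  exact hD s

end ArtinSchreierOrder

end SurfaceRamification

/-! ### Poles along unramified primes. -/

namespace SurfaceRamification

open IsLocalRing

/-- With `Y = W * h ^ j` the three terms have orders `p * j`, `n * (p - 1) + j` and `n * (p - 1)`.
The first and the last must balance, which gives `p ∣ n`; comparing leading coefficients gives the
congruence. Here `Y / (h ^ n * u)` is the Artin-Schreier generator. -/
theorem exists_residue_pow_eq {S : Type*} [CommRing S] [IsDomain S] [IsDiscreteValuationRing S]
    {p n : ℕ} (hp : 1 < p) (hn : 1 ≤ n) {h u f Y : S} (hh : Irreducible h) (hu : IsUnit u)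
    (hf : IsUnit f) (hY : Y ^ p - (h ^ n * u) ^ (p - 1) * Y = (h ^ n * u) ^ (p - 1) * f) :
    ∃ (k : ℕ) (W : S), n = p * k ∧ h ∣ W ^ p - u ^ (p - 1) * f := by
  obtain ⟨l, rfl⟩ : ∃ l, p = l + 2 := ⟨p - 2, by omega⟩
  simp only [show l + 2 - 1 = l + 1 by omega] at *
  have hY0 : Y ≠ 0 := by
    rintro rfl
    have : (h ^ n * u) ^ (l + 1) * f ≠ 0 :=
      mul_ne_zero (pow_ne_zero _ (mul_ne_zero (pow_ne_zero _ hh.ne_zero) hu.ne_zero)) hf.ne_zero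
    apply this
    rw [← hY]; ring
  obtain ⟨j, W, rfl⟩ := IsDiscreteValuationRing.eq_unit_mul_pow_irreducible hY0 hh
  have hnd : ∀ w : S, IsUnit w → ¬ h ∣ w := fun w hw hd => hh.not_isUnit (isUnit_of_dvd_unit hd hw)
  have hE : (W : S) ^ (l + 2) * h ^ (j * (l + 2)) - u ^ (l + 1) * W * h ^ (n * (l + 1) + j) =
      u ^ (l + 1) * f * h ^ (n * (l + 1)) := by
    rw [pow_add h, pow_mul, pow_mul]
    linear_combination hY
  rcases lt_trichotomy (j * (l + 2)) (n * (l + 1)) with hlt | heq | hgt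
  · obtain ⟨r, hr⟩ := Nat.exists_eq_add_of_lt hlt
    exfalso
    refine hnd _ (W.isUnit.pow (l + 2)) ⟨u ^ (l + 1) * W * h ^ (r + j) +
      u ^ (l + 1) * f * h ^ r, ?_⟩
    refine mul_right_cancel₀ (pow_ne_zero (j * (l + 2)) hh.ne_zero) ?_
    rw [hr] at hE
    linear_combination hE
  · have hdvd : (l + 2) ∣ n := by
      refine Nat.Coprime.dvd_of_dvd_mul_right (n := l + 1) ?_ ⟨j, by rw [← heq, mul_comm]⟩
      rw [show l + 2 = (l + 1) + 1 from rfl]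
      simp
    obtain ⟨k, hk⟩ := hdvd
    refine ⟨k, W, hk, ?_⟩
    -- A positive `j` puts the middle term one order beyond the other two.
    have hj : 1 ≤ j := by
      by_contra hj
      obtain rfl : j = 0 := by omega
      have : 0 < n * (l + 1) := by positivity
      omega
    obtain ⟨i, rfl⟩ := Nat.exists_eq_add_of_le hj
    refine ⟨u ^ (l + 1) * W * h ^ i, ?_⟩
    refine mul_right_cancel₀ (pow_ne_zero (n * (l + 1)) hh.ne_zero) ?_
    rw [heq] at hE
    linear_combination hE
  · obtain ⟨r, hr⟩ := Nat.exists_eq_add_of_lt hgt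
    exfalso
    have hj : 1 ≤ j := by
      by_contra hj
      obtain rfl : j = 0 := by omega
      omega
    obtain ⟨i, rfl⟩ := Nat.exists_eq_add_of_le hj
    refine hnd _ ((hu.pow (l + 1)).mul hf) ⟨(W : S) ^ (l + 2) * h ^ r - u ^ (l + 1) * W * h ^ i, ?_⟩
    refine mul_right_cancel₀ (pow_ne_zero (n * (l + 1)) hh.ne_zero) ?_
    rw [hr] at hE
    linear_combination -hE

theorem mem_range_of_pow_mem_range {F E : Type*} [Field F] [Field E] [Algebra F E]
    [Algebra.IsSeparable F E] {p : ℕ} [Fact p.Prime] [CharP F p] {w : E} {a : F}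
    (h : w ^ p = algebraMap F E a) : ∃ c, algebraMap F E c = w := by
  have : ExpChar F p := ExpChar.prime Fact.out
  have hw : w ∈ perfectClosure F E := by
    rw [mem_perfectClosure_iff, ringExpChar.eq F p]
    exact ⟨1, a, by rw [pow_one, h]⟩
  rw [perfectClosure.eq_bot_of_isSeparable] at hw
  exact IntermediateField.mem_bot.1 hw

/-- Unramifiedness enters twice: `h` stays a uniformizer above, so the pole order is a multiple of
`p`; and the residue extension is separable, so the `p`-th root of the leading coefficient found
above already lies in the residue field below, where it is a fraction. -/
theorem exists_pow_of_isUnramifiedAt {A K L : Type*} [CommRing A] [Field K] [Algebra A K]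
    [Field L] [Algebra K L] [Algebra A L] [IsScalarTower A K L]
    [IsDomain A] [IsIntegrallyClosed A] [IsNoetherianRing A] [IsFractionRing A K]
    [FiniteDimensional K L] [Algebra.IsSeparable K L] {p : ℕ} [Fact p.Prime] [CharP A p]
    {x : L} {f h u : A} {n : ℕ} (hh : Prime h) (hn : 1 ≤ n) (hf : ¬ h ∣ f) (hu : ¬ h ∣ u)
    (hx : (x ^ p - x) * algebraMap A L (h ^ n * u) = algebraMap A L f)
    (q : Ideal (integralClosure A L)) [q.IsPrime] (hq : q.under A = Ideal.span {h})
    [Algebra.IsUnramifiedAt A q] :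
    ∃ (k : ℕ) (γ₁ γ₂ : A), n = p * k ∧ ¬ h ∣ γ₂ ∧ h ∣ f * γ₂ ^ p - γ₁ ^ p * u := by
  have hp := (Fact.out : p.Prime)
  set c : Ideal A := Ideal.span {h}
  have hcp : c.IsPrime := (Ideal.span_singleton_prime hh.ne_zero).2 hh
  have hlo : q.LiesOver c := ⟨hq.symm⟩
  have hfin : Module.Finite A (integralClosure A L) := IsIntegralClosure.finite A K L _
  have : IsNoetherianRing (integralClosure A L) := IsIntegralClosure.isNoetherianRing A K L _
  have hinj : Function.Injective (algebraMap A L) := by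
    rw [IsScalarTower.algebraMap_eq A K L]
    exact (algebraMap K L).injective.comp (IsFractionRing.injective A K)
  let := Localization.AtPrime.algebraOfLiesOver c q
  have hsepmap := (Algebra.isUnramifiedAt_iff_map_eq A c q).1 inferInstance
  have hsep := hsepmap.1
  have hmap := hsepmap.2
  rw [Ideal.map_span, Set.image_singleton] at hmap
  have hunit : ∀ z : A, ¬ h ∣ z → IsUnit (algebraMap A (Localization.AtPrime q) z) := by
    intro z hz
    rw [IsScalarTower.algebraMap_apply A (integralClosure A L)]
    refine (IsLocalization.AtPrime.isUnit_to_map_iff _ q _).2 fun hzq => hz ?_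
    exact Ideal.mem_span_singleton.1 (hq.le (show z ∈ q.under A from hzq))
  have hinj' : Function.Injective (algebraMap A (Localization.AtPrime q)) := by
    rw [IsScalarTower.algebraMap_eq A (integralClosure A L), RingHom.coe_comp]
    refine (IsLocalization.injective (Localization.AtPrime q) q.primeCompl_le_nonZeroDivisors).comp ?_
    intro z w hzw
    exact hinj (congrArg Subtype.val hzw)
  set h' := algebraMap A (Localization.AtPrime q) h
  have hh0 : h' ≠ 0 := fun h0 => hh.ne_zero (hinj' (by rw [map_zero]; exact h0))
  have hdvr : IsDiscreteValuationRing (Localization.AtPrime q) := by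
    have hF : ¬ IsField (Localization.AtPrime q) := by
      rw [isField_iff_maximalIdeal_eq, ← hmap, Ideal.span_singleton_eq_bot]
      exact hh0
    exact ((IsDiscreteValuationRing.TFAE _ hF).out 4 0 :).1 ⟨h', hmap.symm⟩
  have hirr : Irreducible h' :=
    (IsDiscreteValuationRing.irreducible_iff_uniformizer h').2 hmap.symm
  set y : L := algebraMap A L (h ^ n * u) * x
  have hy := mul_pow_sub_pow_mul_mul hp.pos hx
  have hyi : IsIntegral A y := isIntegral_of_pow_sub_mul_eq hp.one_lt hy
  set Y : integralClosure A L := ⟨y, hyi⟩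
  have hYeq : Y ^ p - algebraMap A _ ((h ^ n * u) ^ (p - 1)) * Y =
    algebraMap A _ ((h ^ n * u) ^ (p - 1) * f) := Subtype.ext hy
  have hYS := congrArg (algebraMap _ (Localization.AtPrime q)) hYeq
  simp only [map_sub, map_mul, map_pow, ← IsScalarTower.algebraMap_apply] at hYS
  obtain ⟨k, W, hk, hW⟩ := exists_residue_pow_eq hp.one_lt hn hirr (hunit u hu) (hunit f hf) hYS
  have : CharP c.ResidueField p := by
    rw [CharP.charP_iff_prime_eq_zero hp, ← map_natCast (algebraMap A c.ResidueField),
      CharP.cast_eq_zero, map_zero]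
  have hWr : (residue _ W) ^ p = algebraMap c.ResidueField q.ResidueField
      (algebraMap A c.ResidueField (u ^ (p - 1) * f)) := by
    rw [← IsScalarTower.algebraMap_apply, ← map_pow, ← sub_eq_zero]
    rw [IsScalarTower.algebraMap_apply A (Localization.AtPrime q) q.ResidueField]
    change residue _ _ - residue _ _ = 0
    rw [← map_sub, residue_eq_zero_iff, ← hmap, Ideal.mem_span_singleton]
    simpa using hW
  obtain ⟨w, hw⟩ := mem_range_of_pow_mem_range hWr
  rw [← hw, ← map_pow] at hWr
  have hwp := (algebraMap c.ResidueField q.ResidueField).injective hWr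
  obtain ⟨g₁, g₂, hg₂, rfl⟩ := IsFractionRing.div_surjective (A := A ⧸ c) w
  obtain ⟨g₁, rfl⟩ := Ideal.Quotient.mk_surjective g₁
  obtain ⟨g₂, rfl⟩ := Ideal.Quotient.mk_surjective g₂
  change (algebraMap A c.ResidueField g₁ / algebraMap A c.ResidueField g₂) ^ p = _ at hwp
  have hker : ∀ z, algebraMap A c.ResidueField z = 0 ↔ h ∣ z := fun z => by
    rw [Ideal.algebraMap_residueField_eq_zero, Ideal.mem_span_singleton]
  have hg₂' : ¬ h ∣ g₂ := fun hd => nonZeroDivisors.ne_zero hg₂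
    (Ideal.Quotient.eq_zero_iff_mem.2 (Ideal.mem_span_singleton.2 hd))
  -- From `u ^ (p - 1) * f = (g₁ / g₂) ^ p` in the residue field one gets `f / u = (g₁ / (u * g₂)) ^
  -- p`.
  refine ⟨k, g₁, u * g₂, hk, hh.not_dvd_mul hu hg₂', ?_⟩
  rw [div_pow, div_eq_iff (pow_ne_zero _ fun h0 => hg₂' ((hker _).1 h0))] at hwp
  rw [← hker]
  simp only [map_sub, map_mul, map_pow] at hwp ⊢
  rw [hwp]
  obtain ⟨l, rfl⟩ : ∃ l, p = l + 1 := ⟨p - 1, by have := hp.pos; omega⟩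
  simp only [Nat.add_sub_cancel]
  ring

end SurfaceRamification

/-! ### Changing the Artin-Schreier generator to control the poles. -/

namespace SurfaceRamification

section Denominators

variable {A K : Type*} [CommRing A] [IsDomain A] [UniqueFactorizationMonoid A] [Field K]
  [Algebra A K] [IsFractionRing A K] {p : ℕ} [Fact p.Prime] [CharP A p]

/-- Induction on the prime factors of the part `D` of the denominator outside `T`. Each step removes
one factor `h` by subtracting `γ ^ p - γ`, where `γ ^ p` has the same leading term along `h`;
hypothesis `hT` supplies a `γ` without poles off `h * T`, so no new prime enters the denominator. -/
theorem exists_mul_pow_eq_algebraMap {T : A} (hT0 : T ≠ 0) {a : K}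
    (hT : ∀ h γ : A, Prime h → ¬ h ∣ T → ¬ h ∣ γ → ∃ (M : ℕ) (s : A), h ∣ T ^ M - γ * s)
    (ha : ∀ h : A, Prime h → ¬ h ∣ T → ∀ (G : K) (n : ℕ) (f u : A), 1 ≤ n → ¬ h ∣ f → ¬ h ∣ u →
      (a + G ^ p - G) * algebraMap A K (h ^ n * u) = algebraMap A K f →
      ∃ (k : ℕ) (γ₁ γ₂ : A), n = p * k ∧ ¬ h ∣ γ₂ ∧ h ∣ f * γ₂ ^ p - γ₁ ^ p * u) :
    ∃ (G : K) (M : ℕ) (w : A), (a + G ^ p - G) * algebraMap A K (T ^ M) = algebraMap A K w := by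
  have hp := (Fact.out : p.Prime)
  have hinj := IsFractionRing.injective A K
  have : CharP K p := charP_of_injective_algebraMap hinj p
  have key : ∀ D : A, D ≠ 0 → ∀ (G : K) (N : ℕ) (w : A),
      (a + G ^ p - G) * algebraMap A K (D * T ^ N) = algebraMap A K w →
      ∃ (G : K) (M : ℕ) (w : A),
        (a + G ^ p - G) * algebraMap A K (T ^ M) = algebraMap A K w := by
    intro D
    induction D using UniqueFactorizationMonoid.induction_on_prime with
    | h₁ => exact fun h => absurd rfl h
    | h₂ D hD =>
      intro _ G N w hw
      obtain ⟨v, hv⟩ := hD.exists_right_inv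
      refine ⟨G, N, w * v, ?_⟩
      have h1 : T ^ N = D * T ^ N * v := by linear_combination (-T ^ N) * hv
      rw [h1, map_mul, ← mul_assoc, hw, map_mul]
    | h₃ D h hD0 hh ih =>
      intro _ G N w hw
      by_cases hhT : h ∣ T
      · obtain ⟨c, hc⟩ := hhT
        refine ih hD0 G (N + 1) (w * c) ?_
        have h1 : D * T ^ (N + 1) = h * D * T ^ N * c := by
          rw [pow_succ]
          nth_rewrite 2 [hc]
          ring
        rw [h1, map_mul, ← mul_assoc, hw, map_mul]
      have hh0 : algebraMap A K h ≠ 0 := fun h0 => hh.ne_zero (hinj (by rw [h0, map_zero]))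
      by_cases hhw : h ∣ w
      · obtain ⟨c, rfl⟩ := hhw
        refine ih hD0 G N c (mul_left_cancel₀ hh0 ?_)
        simp only [map_mul] at hw ⊢
        linear_combination hw
      have hx0 : h * D * T ^ N ≠ 0 := mul_ne_zero (mul_ne_zero hh.ne_zero hD0) (pow_ne_zero _ hT0)
      obtain ⟨n, u, hu, hnu⟩ := WfDvdMonoid.max_power_factor hx0 hh.irreducible
      have hn : 1 ≤ n := by
        by_contra hn
        obtain rfl : n = 0 := by omega
        exact hu ⟨D * T ^ N, by linear_combination -hnu⟩
      obtain ⟨k, γ₁, γ₂, hnk, hγ₂, hγ⟩ := ha h hh hhT G n w u hn hhw hu (by rw [← hnu, hw])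
      -- The denominator `γ₂` of the leading coefficient is traded for `T ^ M`: modulo `h`, the
      -- fraction `γ₁ / γ₂` equals `γ₁ * s / T ^ M`.
      obtain ⟨M, s, hMs⟩ := hT h γ₂ hh hhT hγ₂
      have hz : h ∣ w * (T ^ M) ^ p - (γ₁ * s) ^ p * u := by
        have h1 : h ∣ (T ^ M) ^ p - (γ₂ * s) ^ p := hMs.trans (sub_dvd_pow_sub_pow _ _ p)
        have h2 : w * (T ^ M) ^ p - (γ₁ * s) ^ p * u =
            w * ((T ^ M) ^ p - (γ₂ * s) ^ p) + s ^ p * (w * γ₂ ^ p - γ₁ ^ p * u) := by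
          rw [mul_pow, mul_pow]; ring
        rw [h2]
        exact dvd_add (h1.mul_left _) (hγ.mul_left _)
      obtain ⟨z, hz⟩ := hz
      have hk1 : 1 ≤ k := by
        by_contra hk
        obtain rfl : k = 0 := by omega
        omega
      -- The linear term `γ` has a pole of order only `k < n` along `h`, so it does not disturb the
      -- cancellation.
      have hkn : k + 1 ≤ n := by
        have := Nat.mul_le_mul_right k hp.two_le
        omega
      obtain ⟨i, hi⟩ := Nat.exists_eq_add_of_le hkn
      obtain ⟨l, hl⟩ : ∃ l, p = l + 1 := ⟨p - 1, by have := hp.pos; omega⟩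
      have hT0' : algebraMap A K T ≠ 0 := fun h0 => hT0 (hinj (by rw [h0, map_zero]))
      set γ : K := algebraMap A K (γ₁ * s) / (algebraMap A K T ^ M * algebraMap A K h ^ k) with hγd
      have e1 : γ * (algebraMap A K T ^ M * algebraMap A K h ^ k) = algebraMap A K (γ₁ * s) :=
        div_mul_cancel₀ _ (mul_ne_zero (pow_ne_zero _ hT0') (pow_ne_zero _ hh0))
      have e2 : γ ^ p * ((algebraMap A K T ^ M) ^ p * algebraMap A K h ^ n) =
          algebraMap A K (γ₁ * s) ^ p := by
        rw [← e1, mul_pow, mul_pow, hnk, ← pow_mul _ k p, mul_comm k p]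
      refine ih hD0 (G - γ) (N + M * p) (z + γ₁ * s * (T ^ M) ^ l * h ^ i * u)
        (mul_left_cancel₀ hh0 ?_)
      have hz' := congrArg (algebraMap A K) hz
      have hnu' := congrArg (algebraMap A K) hnu
      rw [sub_pow_char]
      have e3 : algebraMap A K h ^ n = algebraMap A K h ^ k * algebraMap A K h ^ i *
          algebraMap A K h := by rw [hi]; ring
      have e4 : (algebraMap A K T ^ M) ^ p = (algebraMap A K T ^ M) ^ l * algebraMap A K T ^ M := by
        rw [hl]; ring
      rw [hnu] at hw
      simp only [map_mul, map_pow, map_add, map_sub] at hw hz' hnu' e1 e2 ⊢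
      rw [pow_add, pow_mul]
      set H := algebraMap A K h
      set Tm := algebraMap A K T ^ M
      linear_combination (Tm ^ p * (a + G ^ p - G - γ ^ p + γ)) * hnu' + Tm ^ p * hw + hz' -
        algebraMap A K u * e2 + γ * algebraMap A K u * Tm ^ p * e3 +
        γ * algebraMap A K u * H ^ k * H ^ i * H * e4 +
        algebraMap A K u * Tm ^ l * H ^ i * H * e1
  obtain ⟨⟨f, D⟩, hfD⟩ := IsLocalization.surj (nonZeroDivisors A) a
  refine key D (nonZeroDivisors.ne_zero D.2) 0 0 f ?_
  rw [zero_pow hp.ne_zero, pow_zero, mul_one, add_zero, sub_zero, hfD]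

end Denominators

/-- Comparing orders, `s * τ ^ (n / p) / γ` is integral. Thus `w / τ ^ n`, if a `p`-th power in the
fraction field, is the `p`-th power of an element with a pole of order at most `n / p`. -/
theorem exists_eq_pow_mul_pow_mod {R : Type*} [CommRing R] [IsDomain R] [IsDiscreteValuationRing R]
    {p n : ℕ} (hp : 0 < p) {τ w γ s : R} (hτ : Irreducible τ) (hγ : γ ≠ 0)
    (h : w * γ ^ p = s ^ p * τ ^ n) : ∃ v, w = v ^ p * τ ^ (n % p) := by
  have hle : γ ∣ s * τ ^ (n / p) := by
    by_cases hs : s = 0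
    · rw [hs, zero_mul]; exact dvd_zero _
    obtain ⟨i, u, rfl⟩ := IsDiscreteValuationRing.eq_unit_mul_pow_irreducible hγ hτ
    obtain ⟨j, v, rfl⟩ := IsDiscreteValuationRing.eq_unit_mul_pow_irreducible hs hτ
    have h1 : τ ^ (i * p) ∣ τ ^ (j * p + n) := by
      refine ⟨(↑v⁻¹ : R) ^ p * w * u ^ p, ?_⟩
      have hv : (v : R) ^ p * (↑v⁻¹ : R) ^ p = 1 := by rw [← mul_pow, Units.mul_inv, one_pow]
      rw [mul_pow, mul_pow, ← pow_mul, ← pow_mul] at h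
      rw [pow_add]
      linear_combination (-τ ^ (j * p) * τ ^ n) * hv - (↑v⁻¹ : R) ^ p * h
    have h2 : i * p ≤ j * p + n := (pow_dvd_pow_iff hτ.ne_zero hτ.not_isUnit).1 h1
    have h3 : i ≤ j + n / p := by
      rw [← Nat.mul_add_div hp, Nat.le_div_iff_mul_le hp, mul_comm p]
      exact h2
    obtain ⟨r, hr⟩ := Nat.exists_eq_add_of_le h3
    refine ⟨↑u⁻¹ * v * τ ^ r, ?_⟩
    have hu : (u : R) * (↑u⁻¹ : R) = 1 := Units.mul_inv u
    rw [mul_assoc, ← pow_add, hr, pow_add]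
    linear_combination (-(v : R) * τ ^ i * τ ^ r) * hu
  obtain ⟨v, hv⟩ := hle
  refine ⟨v, mul_right_cancel₀ (pow_ne_zero p hγ) ?_⟩
  rw [h]
  nth_rewrite 1 [← Nat.div_add_mod n p]
  rw [pow_add, mul_comm p, pow_mul, ← mul_assoc, ← mul_pow, hv]
  ring

section Denominators

variable {A K : Type*} [CommRing A] [IsDomain A] [UniqueFactorizationMonoid A] [Field K]
  [Algebra A K] [IsFractionRing A K] {p : ℕ} [Fact p.Prime] [CharP A p]

/-- A pole along `t₁` of order beyond `m` cannot come from `a`, so it comes from `G ^ p`: its order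
is divisible by `p` and its leading coefficient is a `p`-th power on the curve `t₁ = 0`. As `t₂` is
a uniformizer there, the root can be lifted with denominator `t₂ ^ (n₂ / p)`, so lowering the pole
along `t₁` leaves the bound `n₂` along `t₂` intact. -/
theorem exists_reduce_pole {t₁ t₂ : A} (ht₁ : Prime t₁) [(Ideal.span {t₁}).IsPrime]
    [IsDiscreteValuationRing (A ⧸ Ideal.span {t₁})]
    (ht₂ : Irreducible (Ideal.Quotient.mk (Ideal.span {t₁}) t₂)) {a : K} {m n₂ : ℕ} {α β : A}
    (hβ : ¬ t₁ ∣ β) (ha : a * algebraMap A K (t₁ ^ m * β) = algebraMap A K α) (n₁ : ℕ) :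
    ∀ (G : K) (w : A), (a + G ^ p - G) * algebraMap A K (t₁ ^ n₁ * t₂ ^ n₂) = algebraMap A K w →
      ∃ (G : K) (w : A),
        (a + G ^ p - G) * algebraMap A K (t₁ ^ m * t₂ ^ n₂) = algebraMap A K w := by
  have hp := (Fact.out : p.Prime)
  have hinj := IsFractionRing.injective A K
  have : CharP K p := charP_of_injective_algebraMap hinj p
  have hmk : ∀ z, Ideal.Quotient.mk (Ideal.span {t₁}) z = 0 ↔ t₁ ∣ z := fun z => by
    rw [Ideal.Quotient.eq_zero_iff_mem, Ideal.mem_span_singleton]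
  have ht12 : ¬ t₁ ∣ t₂ := fun hd => ht₂.ne_zero ((hmk _).2 hd)
  have hn0 : ∀ {z : A}, z ≠ 0 → algebraMap A K z ≠ 0 := fun hz h0 =>
    hz (hinj (by rw [h0, map_zero]))
  have ht₁0 := hn0 ht₁.ne_zero
  have ht₂0' : t₂ ≠ 0 := fun h0 => ht12 (h0 ▸ dvd_zero _)
  have ht₂0 := hn0 ht₂0'
  induction n₁ with
  | zero =>
    intro G w hw
    refine ⟨G, t₁ ^ m * w, ?_⟩
    rw [map_mul _ _ w, ← hw]
    simp only [map_mul, map_pow, pow_zero, one_mul]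
    ring
  | succ n ih =>
    intro G w hw
    by_cases hnm : n + 1 ≤ m
    · obtain ⟨r, rfl⟩ := Nat.exists_eq_add_of_le hnm
      refine ⟨G, t₁ ^ r * w, ?_⟩
      rw [map_mul _ _ w, ← hw]
      simp only [map_mul, map_pow, pow_add]
      ring
    by_cases htw : t₁ ∣ w
    · obtain ⟨c, rfl⟩ := htw
      refine ih G c (mul_left_cancel₀ ht₁0 ?_)
      rw [← map_mul _ _ c, ← hw]
      simp only [map_mul, map_pow, pow_succ]
      ring
    obtain ⟨s, d, hrel, hsd⟩ := IsFractionRing.exists_reduced_fraction A G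
    have hd0 : (d : A) ≠ 0 := nonZeroDivisors.ne_zero d.2
    obtain ⟨k, γ, hγ, hdk⟩ := WfDvdMonoid.max_power_factor hd0 ht₁.irreducible
    have hGd : G * algebraMap A K (t₁ ^ k * γ) = algebraMap A K s := by
      rw [← hdk, ← hsd, IsLocalization.mk'_spec]
    obtain ⟨l, hl⟩ : ∃ l, p = l + 2 := ⟨p - 2, by have := hp.two_le; omega⟩
    -- The equation for `w`, cleared of all denominators, with `G = s / (t₁ ^ k * γ)` in lowest
    -- terms.
    have hE : α * (t₁ ^ (n + 1) * t₂ ^ n₂) * (t₁ ^ (p * k) * γ ^ p) +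
        s ^ p * (t₁ ^ m * β) * (t₁ ^ (n + 1) * t₂ ^ n₂) -
        s * (t₁ ^ k * γ) ^ (l + 1) * (t₁ ^ m * β) * (t₁ ^ (n + 1) * t₂ ^ n₂) =
        w * (t₁ ^ m * β) * (t₁ ^ (p * k) * γ ^ p) := by
      have e1 : t₁ ^ (p * k) * γ ^ p = (t₁ ^ k * γ) ^ p := by rw [mul_pow, ← pow_mul, mul_comm k]
      have e2 : G ^ p * algebraMap A K (t₁ ^ k * γ) ^ p = algebraMap A K s ^ p := by
        rw [← hGd, mul_pow]
      rw [e1]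
      apply hinj
      simp only [map_add, map_sub, map_mul _ _ ((_ : A) ^ p), map_mul _ _ (_ * β),
        map_mul _ _ (_ * t₂ ^ n₂), map_mul _ s, map_pow _ _ p, map_pow _ _ (l + 1)]
      set δ := algebraMap A K (t₁ ^ k * γ)
      set x := algebraMap A K (t₁ ^ (n + 1) * t₂ ^ n₂)
      set y := algebraMap A K (t₁ ^ m * β)
      have e3 : δ ^ p = δ ^ (l + 1) * δ := by rw [hl]; ring
      linear_combination (δ ^ p * y) * hw - (x * δ ^ p) * ha - x * y * e2 +
        δ ^ (l + 1) * x * y * hGd + G * x * y * e3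
    obtain ⟨q, hq⟩ := Nat.exists_eq_add_of_le (show m ≤ n by omega)
    -- Either `G ^ p` has a pole of order at least `n + 1`, or every term has a pole of order at
    -- most `n`, which contradicts `¬ t₁ ∣ w`.
    rcases Nat.lt_or_ge n (p * k) with hlt | hge
    · obtain ⟨r, hr⟩ := Nat.exists_eq_add_of_le (show n + 1 ≤ p * k from hlt)
      have hk : 1 ≤ k := by
        by_contra hk
        obtain rfl : k = 0 := by omega
        omega
      obtain ⟨k', rfl⟩ := Nat.exists_eq_add_of_le hk
      have hd1 : t₁ ∣ w * β * t₁ ^ r * γ ^ p - s ^ p * β * t₂ ^ n₂ := by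
        refine ⟨α * t₂ ^ n₂ * t₁ ^ (q + r) * γ ^ p -
          s * (t₁ ^ k' * γ) * (t₁ ^ (1 + k') * γ) ^ l * β * t₂ ^ n₂, ?_⟩
        refine mul_left_cancel₀ (pow_ne_zero (m + (n + 1)) ht₁.ne_zero) ?_
        have e1 : t₁ ^ (p * (1 + k')) = t₁ ^ (n + 1) * t₁ ^ r := by rw [hr, pow_add]
        have e2 : t₁ ^ (n + 1) = t₁ ^ m * t₁ ^ q * t₁ := by rw [hq]; ring
        have e3 : (t₁ ^ (1 + k') * γ) ^ (l + 1) =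
            (t₁ ^ (1 + k') * γ) ^ l * (t₁ * (t₁ ^ k' * γ)) := by ring
        rw [e1, e3] at hE
        rw [pow_add t₁ m, pow_add t₁ q]
        generalize (t₁ ^ (1 + k') * γ) ^ l = y at hE ⊢
        linear_combination (-1) * hE + α * t₂ ^ n₂ * t₁ ^ (n + 1) * t₁ ^ r * γ ^ p * e2
      -- If `G ^ p` had a pole of order beyond `n + 1`, it would have to cancel, forcing `t₁ ∣ s`
      -- although the fraction for `G` is reduced.
      obtain rfl : r = 0 := by
        by_contra hr0
        obtain ⟨r', rfl⟩ := Nat.exists_eq_succ_of_ne_zero hr0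
        have h1 : t₁ ∣ s ^ p * β * t₂ ^ n₂ := by
          rw [← sub_sub_cancel (w * β * t₁ ^ (r' + 1) * γ ^ p) (s ^ p * β * t₂ ^ n₂)]
          exact dvd_sub ⟨w * β * t₁ ^ r' * γ ^ p, by ring⟩ hd1
        have h2 : t₁ ∣ s := by
          rcases ht₁.dvd_or_dvd h1 with h1 | h1
          · exact ht₁.dvd_of_dvd_pow ((ht₁.dvd_or_dvd h1).resolve_right hβ)
          · exact absurd (ht₁.dvd_of_dvd_pow h1) ht12
        have h3 : t₁ ∣ (d : A) := by rw [hdk]; exact ⟨t₁ ^ k' * γ, by ring⟩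
        exact ht₁.not_isUnit (hrel h2 h3)
      have hd2 : t₁ ∣ w * γ ^ p - s ^ p * t₂ ^ n₂ := by
        have h1 : t₁ ∣ β * (w * γ ^ p - s ^ p * t₂ ^ n₂) := by
          convert hd1 using 1
          ring
        exact (ht₁.dvd_or_dvd h1).resolve_left hβ
      have hd3 := (hmk _).2 hd2
      rw [map_sub, map_mul, map_mul, map_pow, map_pow, map_pow, sub_eq_zero] at hd3
      obtain ⟨v, hv⟩ := exists_eq_pow_mul_pow_mod hp.pos ht₂ (fun h0 => hγ ((hmk _).1 h0)) hd3
      obtain ⟨v, rfl⟩ := Ideal.Quotient.mk_surjective v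
      rw [← map_pow, ← map_pow, ← map_mul, ← sub_eq_zero, ← map_sub, hmk] at hv
      obtain ⟨z, hz⟩ := hv
      rw [add_zero] at hr
      set e := n₂ / p
      have hkn : 1 + k' ≤ n := by
        have := Nat.mul_le_mul_right (1 + k') hp.two_le
        omega
      obtain ⟨i, hi⟩ := Nat.exists_eq_add_of_le hkn
      obtain ⟨j, hj⟩ := Nat.exists_eq_add_of_le (Nat.div_le_self n₂ p)
      -- The correction: `g ^ p` has the leading term of the current element along `t₁`, and `g` has
      -- a pole of order `n₂ / p` at most along `t₂`.
      set g : K := algebraMap A K v / (algebraMap A K t₁ ^ (1 + k') * algebraMap A K t₂ ^ e)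
      have e1 : g * (algebraMap A K t₁ ^ (1 + k') * algebraMap A K t₂ ^ e) = algebraMap A K v :=
        div_mul_cancel₀ _ (mul_ne_zero (pow_ne_zero _ ht₁0) (pow_ne_zero _ ht₂0))
      have e2 : g ^ p * (algebraMap A K t₁ ^ (n + 1) * algebraMap A K t₂ ^ n₂) =
          algebraMap A K v ^ p * algebraMap A K t₂ ^ (n₂ % p) := by
        rw [← e1, mul_pow, mul_pow, ← pow_mul, ← pow_mul, mul_comm _ p, hr, mul_assoc, mul_assoc,
          ← pow_add, mul_comm e p, Nat.div_add_mod]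
      refine ih (G - g) (z + v * t₁ ^ i * t₂ ^ j) (mul_left_cancel₀ ht₁0 ?_)
      have hz' := congrArg (algebraMap A K) hz
      rw [sub_pow_char]
      have e3 : algebraMap A K t₁ ^ n =
          algebraMap A K t₁ ^ (1 + k') * algebraMap A K t₁ ^ i := by rw [hi, pow_add]
      have e4 : algebraMap A K t₂ ^ n₂ = algebraMap A K t₂ ^ e * algebraMap A K t₂ ^ j := by
        rw [← pow_add, ← hj]
      simp only [map_mul, map_pow, map_add, map_sub] at hw hz' ⊢
      have e5 : g * (algebraMap A K t₁ ^ n * algebraMap A K t₂ ^ n₂) = algebraMap A K v *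
          algebraMap A K t₁ ^ i * algebraMap A K t₂ ^ j := by
        rw [e3, e4, ← e1]; ring
      rw [pow_succ] at hw e2
      linear_combination hw - e2 + hz' + algebraMap A K t₁ * e5
    · exfalso
      obtain ⟨r, hr⟩ := Nat.exists_eq_add_of_le hge
      have h1 : t₁ ∣ w * β * γ ^ p := by
        refine ⟨α * t₂ ^ n₂ * t₁ ^ q * γ ^ p + s ^ p * β * t₂ ^ n₂ * t₁ ^ r -
          s * (t₁ ^ k * γ) ^ (l + 1) * β * t₂ ^ n₂ * t₁ ^ r, ?_⟩
        refine mul_left_cancel₀ (pow_ne_zero (m + p * k) ht₁.ne_zero) ?_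
        have e2 : t₁ ^ (n + 1) = t₁ ^ m * t₁ ^ q * t₁ := by rw [hq]; ring
        have e3 : t₁ ^ (n + 1) = t₁ ^ (p * k) * t₁ ^ r * t₁ := by rw [hr]; ring
        rw [pow_add t₁ m]
        generalize (t₁ ^ k * γ) ^ (l + 1) = y at hE ⊢
        linear_combination (-1) * hE + α * t₂ ^ n₂ * t₁ ^ (p * k) * γ ^ p * e2 +
          (s ^ p * t₁ ^ m * β * t₂ ^ n₂ - s * y * t₁ ^ m * β * t₂ ^ n₂) * e3
      rcases ht₁.dvd_or_dvd h1 with h1 | h1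
      · exact (ht₁.dvd_or_dvd h1).elim htw hβ
      · exact hγ (ht₁.dvd_of_dvd_pow h1)

end Denominators

end SurfaceRamification

/-! ### Automorphisms of Artin-Schreier extensions. -/

namespace SurfaceRamification

open Polynomial

section ArtinSchreierExtension

variable {D F E : Type*} [CommRing D] [Field F] [Algebra D F] [IsFractionRing D F]
  [Field E] [Algebra D E] [Algebra F E] [IsScalarTower D F E]

theorem algEquiv_apply_algebraMap (σ : E ≃ₐ[D] E) (f : F) :
    σ (algebraMap F E f) = algebraMap F E f := by
  obtain ⟨a, b, -, rfl⟩ := IsFractionRing.div_surjective (A := D) f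
  rw [map_div₀, map_div₀, ← IsScalarTower.algebraMap_apply, ← IsScalarTower.algebraMap_apply,
    σ.commutes, σ.commutes]

variable (D F E) in
/-- Automorphisms over a domain and over its field of fractions are the same. -/
def algEquivFractionRing : (E ≃ₐ[D] E) ≃ (E ≃ₐ[F] E) where
  toFun σ := { σ with commutes' := algEquiv_apply_algebraMap σ }
  invFun σ := σ.restrictScalars D
  left_inv _ := rfl
  right_inv _ := rfl

theorem algEquiv_eq_one {y : E} (hgen : IntermediateField.adjoin F {y} = ⊤) {σ : E ≃ₐ[D] E}
    (hσ : σ y = y) : σ = 1 := by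
  have h1 : IntermediateField.adjoin F {y} ≤ IntermediateField.fixedField
      (Subgroup.zpowers (algEquivFractionRing D F E σ)) := by
    rw [IntermediateField.adjoin_simple_le_iff]
    rintro ⟨_, n, rfl⟩
    change ((algEquivFractionRing D F E σ) ^ n) y = y
    exact MulAction.mem_stabilizer_iff.1 (Subgroup.zpow_mem
      (MulAction.stabilizer (E ≃ₐ[F] E) y) (MulAction.mem_stabilizer_iff.2 hσ) n)
  ext z
  have hz : z ∈ IntermediateField.adjoin F {y} := hgen ▸ IntermediateField.mem_top
  exact h1 hz ⟨_, Subgroup.mem_zpowers _⟩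

variable {p : ℕ} [CharP F p]

theorem separable_X_pow_sub_X_sub_C (a : F) : (X ^ p - C 1 * X - C a : F[X]).Separable := by
  rw [separable_def, derivative_sub, derivative_sub, derivative_X_pow, CharP.cast_eq_zero]
  simp only [map_zero, zero_mul, derivative_mul, derivative_one, derivative_C, derivative_X,
    zero_sub, sub_zero, map_one, zero_add, mul_one]
  exact isCoprime_one_right.neg_right

variable [Fact p.Prime]

/-- The polynomial is `(X - y) ^ p - (X - y)`, so its roots are the translates of `y` by the prime
field; hence the extension is Galois. -/
theorem card_algEquiv_artinSchreier {y : E} (hgen : IntermediateField.adjoin F {y} = ⊤) {a : F}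
    (hy : y ^ p - y = algebraMap F E a) (hmin : (minpoly F y).natDegree = p) :
    FiniteDimensional F E ∧ Nat.card (E ≃ₐ[D] E) = p := by
  have hp := (Fact.out : p.Prime)
  have : CharP E p := charP_of_injective_algebraMap (algebraMap F E).injective p
  have hint : IsIntegral F y :=
    isIntegral_of_pow_sub_mul_eq hp.one_lt (c := 1) (e := a) (by rw [map_one, one_mul, hy])
  have hfin : FiniteDimensional F E := by
    have := IntermediateField.adjoin.finiteDimensional hint
    rw [hgen] at this
    exact IntermediateField.topEquiv.toLinearEquiv.finiteDimensional
  refine ⟨hfin, ?_⟩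
  have hroot : y ∈ (X ^ p - C 1 * X - C a : F[X]).rootSet E := by
    rw [mem_rootSet]
    refine ⟨(monic_X_pow_sub_C_mul_X_sub_C hp.one_lt 1 a).ne_zero, ?_⟩
    simp [hy]
  have hsplit : IsSplittingField F E (X ^ p - C 1 * X - C a : F[X]) := by
    constructor
    · have h1 : ((X ^ p - C 1 * X - C a : F[X]).map (algebraMap F E)) =
          (((X ^ p - X : (ZMod p)[X]).map (ZMod.castHom dvd_rfl E))).comp (X - C y) := by
        simp only [Polynomial.map_sub, Polynomial.map_pow, map_X, map_C,
          sub_comp, pow_comp, X_comp, ← hy, map_one, one_mul, sub_pow_char, map_sub, map_pow]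
        ring
      have h2 : (X ^ p - X : (ZMod p)[X]).Splits := by
        have := FiniteField.splits_X_pow_card_sub_X (p := p) (K := ZMod p)
        rwa [ZMod.card, Algebra.algebraMap_self, Polynomial.map_id] at this
      rw [h1]
      exact (h2.map _).comp_of_natDegree_le_one_of_monic (natDegree_X_sub_C y).le
        (monic_X_sub_C y)
    · rw [eq_top_iff,
        ← (IntermediateField.adjoin_simple_eq_top_iff_of_isAlgebraic hint.isAlgebraic).1 hgen]
      exact Algebra.adjoin_mono (Set.singleton_subset_iff.2 hroot)
  have hgal : IsGalois F E :=
    IsGalois.of_separable_splitting_field (separable_X_pow_sub_X_sub_C (p := p) a)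
  rw [Nat.card_congr (algEquivFractionRing D F E), IsGalois.card_aut_eq_finrank, ← hmin]
  exact ((Field.primitive_element_iff_minpoly_natDegree_eq F y).1 hgen).symm

/-- For `σ ≠ 1` the difference `σ y - y` is a nonzero solution of `z ^ p = z`, hence a unit, and it
cannot lie in `P`. No assumption on the degree is needed, so the trivial and the split cases are
covered. -/
theorem lowerGroup_eq_bot [CharP D p] {y : E} (hgen : IntermediateField.adjoin F {y} = ⊤) {d : D}
    (hy : y ^ p - y = algebraMap D E d) (P : Ideal (integralClosure D E)) (hP : P ≠ ⊤) (i : ℕ) :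
    lowerGroup D P i = ⊥ := by
  have hp := (Fact.out : p.Prime)
  have : CharP E p := charP_of_injective_algebraMap (algebraMap F E).injective p
  have hint : IsIntegral D y :=
    isIntegral_of_pow_sub_mul_eq hp.one_lt (c := 1) (e := d) (by rw [map_one, one_mul, hy])
  rw [eq_bot_iff]
  intro σ hσ
  rw [Subgroup.mem_bot]
  by_contra hne
  have h1 : σ • (⟨y, hint⟩ : integralClosure D E) - ⟨y, hint⟩ ∈ P ^ (i + 1) := hσ _
  set z : integralClosure D E := σ • (⟨y, hint⟩ : integralClosure D E) - ⟨y, hint⟩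
  have hz : (z : E) = σ y - y := rfl
  have hz0 : (z : E) ≠ 0 := fun h0 => hne (algEquiv_eq_one (F := F) hgen (sub_eq_zero.1 (hz ▸ h0)))
  have hzp : (z : E) ^ p = z := by
    have h2 : σ (y ^ p - y) = y ^ p - y := by rw [hy, σ.commutes]
    rw [map_sub, map_pow] at h2
    rw [hz, sub_pow_char]
    linear_combination h2
  have hz1 : z ^ (p - 1) = 1 := by
    apply Subtype.ext
    push_cast
    refine mul_right_cancel₀ hz0 ?_
    rw [← pow_succ, Nat.sub_add_cancel hp.pos, hzp, one_mul]
  apply hP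
  rw [Ideal.eq_top_iff_one, ← hz1]
  exact Ideal.pow_mem_of_mem _ (Ideal.pow_le_self (by omega) h1) _ (by have := hp.two_le; omega)

end ArtinSchreierExtension

end SurfaceRamification

/-! ### Valuations of polynomials in a generator with a pole of order prime to `p`. -/

namespace SurfaceRamification

open Polynomial WithZero

section Valuation

variable {E : Type*} [Field E] (v : Valuation E ℤᵐ⁰)

theorem valuation_eq_one_of_pow_eq_self {p : ℕ} (hp : 1 < p) {ζ : E} (hζ : ζ ^ p = ζ)
    (h0 : ζ ≠ 0) : v ζ = 1 := by
  have h1 : ζ ^ (p - 1) = 1 := by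
    refine mul_right_cancel₀ h0 ?_
    rw [← pow_succ, Nat.sub_add_cancel hp.le, hζ, one_mul]
  have h2 : v ζ ^ (p - 1) = 1 := by rw [← map_pow, h1, map_one]
  have h3 : p - 1 ≠ 0 := by omega
  rcases lt_trichotomy (v ζ) 1 with hlt | heq | hgt
  · exact absurd h2 (pow_lt_one₀ zero_le hlt h3).ne
  · exact heq
  · exact absurd h2 (one_lt_pow₀ hgt h3).ne'

theorem valuation_natCast_eq_one {p : ℕ} [Fact p.Prime] [CharP E p] {i : ℕ} (hi : ¬ p ∣ i) :
    v (i : E) = 1 := by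
  refine valuation_eq_one_of_pow_eq_self v (Fact.out : p.Prime).one_lt ?_
    fun h0 => hi ((CharP.cast_eq_zero_iff E p i).1 h0)
  exact map_natCast (frobenius E p) i

variable {v} {y ζ : E}

theorem valuation_add_pow_le (hy : 1 ≤ v y) (hζ : v ζ ≤ 1) (i : ℕ) :
    v ((y + ζ) ^ i) ≤ v y ^ i := by
  rw [map_pow]
  exact pow_le_pow_left₀ zero_le ((v.map_add y ζ).trans (max_le le_rfl (hζ.trans hy))) i

theorem valuation_add_pow_sub_pow_le (hy : 1 ≤ v y) (hζ : v ζ ≤ 1) (i : ℕ) :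
    v ((y + ζ) ^ i - y ^ i) * v y ≤ v y ^ i := by
  induction i with
  | zero => simp
  | succ i ih =>
    have h1 : (y + ζ) ^ (i + 1) - y ^ (i + 1) = (y + ζ) ^ i * ζ + y * ((y + ζ) ^ i - y ^ i) := by
      ring
    rw [h1]
    refine (mul_le_mul_left (v.map_add _ _) _).trans ?_
    rw [max_mul, max_le_iff]
    constructor
    · rw [map_mul, pow_succ]
      refine mul_le_mul_left ?_ _
      exact (mul_le_mul' (valuation_add_pow_le hy hζ i) hζ).trans (mul_one _).le
    · rw [map_mul, mul_assoc, pow_succ' (v y)]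
      exact mul_le_mul_right ih _

/-- The second-order part of the binomial expansion; multiplication by `v y` on the left avoids the
exponent `i - 1`. -/
theorem valuation_add_pow_sub_pow_sub_le (hy : 1 ≤ v y) (hζ : v ζ ≤ 1) (i : ℕ) :
    v ((y + ζ) ^ (i + 1) - y ^ (i + 1) - (i + 1 : ℕ) * ζ * y ^ i) * v y ≤ v y ^ i := by
  induction i with
  | zero => simp
  | succ i ih =>
    have h1 : (y + ζ) ^ (i + 1 + 1) - y ^ (i + 1 + 1) - (i + 1 + 1 : ℕ) * ζ * y ^ (i + 1) =
        y * ((y + ζ) ^ (i + 1) - y ^ (i + 1) - (i + 1 : ℕ) * ζ * y ^ i) +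
          ζ * ((y + ζ) ^ (i + 1) - y ^ (i + 1)) := by
      push_cast
      ring
    rw [h1]
    refine (mul_le_mul_left (v.map_add _ _) _).trans ?_
    rw [max_mul, max_le_iff]
    constructor
    · rw [map_mul, mul_assoc, pow_succ' (v y)]
      exact mul_le_mul_right ih _
    · rw [map_mul, mul_assoc]
      exact (mul_le_mul' hζ (valuation_add_pow_sub_pow_le hy hζ _)).trans (one_mul _).le

/-- The linear term `(i + 1) * ζ * y ^ i` of the binomial expansion dominates, since `i + 1` is
invertible in characteristic `p`. -/
theorem valuation_add_pow_sub_pow_eq {p : ℕ} [Fact p.Prime] [CharP E p] (hy : 1 < v y)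
    (hζ : v ζ = 1) {i : ℕ} (hi : ¬ p ∣ i + 1) : v ((y + ζ) ^ (i + 1) - y ^ (i + 1)) = v y ^ i := by
  have h1 := valuation_add_pow_sub_pow_sub_le hy.le hζ.le i
  have h2 : v ((i + 1 : ℕ) * ζ * y ^ i) = v y ^ i := by
    rw [map_mul, map_mul, valuation_natCast_eq_one v hi, hζ, one_mul, one_mul, map_pow]
  have hy0 : 0 < v y := zero_lt_one.trans hy
  have h3 : v ((y + ζ) ^ (i + 1) - y ^ (i + 1) - (i + 1 : ℕ) * ζ * y ^ i) < v y ^ i := by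
    by_contra hcon
    rw [not_lt] at hcon
    have h4 := (mul_le_mul_left hcon (v y)).trans h1
    have h5 : v y ^ i * 1 < v y ^ i * v y := mul_lt_mul_of_pos_left hy (pow_pos hy0 i)
    rw [mul_one] at h5
    exact absurd h4 (not_le.2 h5)
  rw [← h2] at h3
  have h6 := v.map_add_eq_of_lt_left h3
  rw [add_sub_cancel, h2] at h6
  exact h6

variable {F : Type*} [Field F] [Algebra F E] {p h : ℕ}

/-- Modulo `p` the exponents `h * j` with `0 ≤ j < p` are distinct, so no two monomials have the
same valuation and the largest one decides. The scale `e` is kept because the value group is not yet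
normalised when this is first applied. -/
theorem exists_valuation_aeval_eq (hp : p.Prime) {e : ℤ} (he : 0 < e) (hh : ¬ p ∣ h)
    (hF : ∀ f : F, f ≠ 0 → ∃ n : ℤ, v (algebraMap F E f) = exp (e * (p * n)))
    (hy : v y = exp (e * h)) {q : F[X]} (hq0 : q ≠ 0) (hq : q.natDegree < p) :
    ∃ i ∈ q.support, v (aeval y q) = v (algebraMap F E (q.coeff i) * y ^ i) ∧
      ∀ j ∈ q.support, v (algebraMap F E (q.coeff j) * y ^ j) ≤ v (aeval y q) := by
  classical
  obtain ⟨i, hi, hmax⟩ := Finset.exists_max_image q.support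
    (fun j => v (algebraMap F E (q.coeff j) * y ^ j)) (nonempty_support_iff.2 hq0)
  have hval : ∀ j ∈ q.support, ∃ n : ℤ, v (algebraMap F E (q.coeff j) * y ^ j) =
      exp (e * (p * n + h * j)) := by
    intro j hj
    obtain ⟨n, hn⟩ := hF _ (mem_support_iff.1 hj)
    refine ⟨n, ?_⟩
    rw [map_mul, map_pow, hn, hy, ← exp_nsmul, ← exp_add]
    congr 1
    rw [nsmul_eq_mul]
    ring
  have hne : ∀ j ∈ q.support, j ≠ i → v (algebraMap F E (q.coeff j) * y ^ j) <
      v (algebraMap F E (q.coeff i) * y ^ i) := by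
    intro j hj hji
    refine lt_of_le_of_ne (hmax j hj) fun heq => hji ?_
    obtain ⟨n, hn⟩ := hval j hj
    obtain ⟨m, hm⟩ := hval i hi
    rw [hn, hm, exp_inj] at heq
    have h1 := mul_left_cancel₀ he.ne' heq
    have h2 : (p : ℤ) ∣ h * (j - i) := ⟨m - n, by linear_combination h1⟩
    have h3 := ((Nat.prime_iff_prime_int.1 hp).dvd_or_dvd h2).resolve_left
      (by exact_mod_cast hh)
    have hjp := (le_natDegree_of_mem_supp j hj).trans_lt hq
    have hip := (le_natDegree_of_mem_supp i hi).trans_lt hq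
    have h4 := Int.eq_zero_of_abs_lt_dvd h3 (by rw [abs_lt]; constructor <;> omega)
    omega
  have hsum : aeval y q = ∑ j ∈ q.support, algebraMap F E (q.coeff j) * y ^ j := by
    rw [aeval_def, eval₂_eq_sum, Polynomial.sum]
  have heq : v (aeval y q) = v (algebraMap F E (q.coeff i) * y ^ i) := by
    rw [hsum]
    refine v.map_sum_eq_of_lt hi fun j hj => ?_
    rw [Finset.mem_sdiff, Finset.mem_singleton] at hj
    exact hne j hj.1 hj.2
  exact ⟨i, hi, heq, fun j hj => heq ▸ hmax j hj⟩

/-- An integral element is a sum of integral monomials `c * y ^ j`. Moving `y` by `σ` multiplies the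
size of each by at most `exp (-h)`, and the monomials with `j > 0` are of size at most `exp (-1)`
already. -/
theorem valuation_algHom_sub_le [Fact p.Prime] [CharP E p] (hh : ¬ p ∣ h)
    (hF : ∀ f : F, f ≠ 0 → ∃ n : ℤ, v (algebraMap F E f) = exp ((p : ℤ) * n))
    (hy : v y = exp (h : ℤ)) (σ : E →ₐ[F] E) (hσ : (σ y - y) ^ p = σ y - y) {q : F[X]}
    (hq : q.natDegree < p) (hq1 : v (aeval y q) ≤ 1) :
    v (σ (aeval y q) - aeval y q) ≤ exp (-((h : ℤ) + 1)) := by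
  have hp := (Fact.out : p.Prime)
  by_cases hq0 : q = 0
  · simp [hq0]
  obtain ⟨-, -, -, hmax⟩ := exists_valuation_aeval_eq hp one_pos hh
    (by simpa only [one_mul] using hF) (by rwa [one_mul]) hq0 hq
  have hζ : v (σ y - y) ≤ 1 := by
    by_cases h0 : σ y - y = 0
    · rw [h0, map_zero]; exact zero_le
    · exact (valuation_eq_one_of_pow_eq_self v hp.one_lt hσ h0).le
  have hy1 : 1 ≤ v y := by
    rw [hy, ← exp_zero, exp_le_exp]
    exact Int.natCast_nonneg h
  have hsum : ∀ z : E, aeval z q = ∑ j ∈ q.support, algebraMap F E (q.coeff j) * z ^ j := by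
    intro z
    rw [aeval_def, eval₂_eq_sum, Polynomial.sum]
  rw [← Polynomial.aeval_algHom_apply, hsum, hsum, ← Finset.sum_sub_distrib]
  refine v.map_sum_le fun j hj => ?_
  rcases Nat.eq_zero_or_pos j with rfl | hj0
  · simp
  have hjp := (le_natDegree_of_mem_supp j hj).trans_lt hq
  obtain ⟨n, hn⟩ := hF _ (mem_support_iff.1 hj)
  have h1 := (hmax j hj).trans hq1
  have h2 : v y ^ j = exp ((h : ℤ) * j) := by
    rw [hy, ← exp_nsmul, nsmul_eq_mul, mul_comm]
  rw [map_mul, map_pow, hn, h2, ← exp_add, ← exp_zero, exp_le_exp] at h1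
  -- This gains the last unit in the exponent: a monomial with `0 < j < p` cannot be a unit, as `p`
  -- does not divide `h * j`.
  have h3 : (p : ℤ) * n + h * j ≠ 0 := by
    intro h0
    have h4 : (p : ℤ) ∣ (h * j : ℕ) := ⟨-n, by push_cast; linear_combination h0⟩
    rcases (Nat.Prime.dvd_mul hp).1 (Int.natCast_dvd_natCast.1 h4) with h4 | h4
    · exact hh h4
    · exact absurd (Nat.le_of_dvd hj0 h4) (by omega)
  have h4 := valuation_add_pow_sub_pow_le hy1 hζ j
  rw [add_sub_cancel, h2, hy] at h4
  rw [← mul_sub, map_mul, hn]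
  have h5 : v (σ y ^ j - y ^ j) ≤ exp ((h : ℤ) * j - h) := by
    rw [exp_sub]
    exact (le_div_iff₀ (by simp)).2 h4
  refine (mul_le_mul_right h5 _).trans ?_
  rw [← exp_add, exp_le_exp]
  omega

end Valuation

end SurfaceRamification

/-! ### The valuation of an Artin-Schreier extension with a pole of order prime to `p`. -/

namespace SurfaceRamification

open Polynomial WithZero IsLocalRing

section RamifiedExtension

variable {D F E : Type*} [CommRing D] [IsDomain D] [IsDiscreteValuationRing D] [Field F]
  [Algebra D F] [IsFractionRing D F] [Field E] [Algebra D E] [Algebra F E] [IsScalarTower D F E]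
  {p : ℕ} [Fact p.Prime] [CharP D p]

theorem finiteDimensional_and_isSeparable_of_artinSchreier {F E : Type*} [Field F] [Field E]
    [Algebra F E] [CharP F p] {y : E}
    (hgen : IntermediateField.adjoin F {y} = ⊤) {a : F} (hy : y ^ p - y = algebraMap F E a) :
    FiniteDimensional F E ∧ Algebra.IsSeparable F E := by
  have hp := (Fact.out : p.Prime)
  have hint : IsIntegral F y :=
    isIntegral_of_pow_sub_mul_eq hp.one_lt (c := 1) (e := a) (by rw [map_one, one_mul, hy])
  constructor
  · have := IntermediateField.adjoin.finiteDimensional hint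
    rw [hgen] at this
    exact IntermediateField.topEquiv.toLinearEquiv.finiteDimensional
  · have hsep : IsSeparable F y :=
      (separable_X_pow_sub_X_sub_C (p := p) a).of_dvd (minpoly.dvd F y (by simp [hy]))
    have := (IntermediateField.isSeparable_adjoin_simple_iff_isSeparable F E).2 hsep
    rw [hgen] at this
    exact Algebra.IsSeparable.of_algHom F _ (IntermediateField.topEquiv (F := F) (E := E)).symm.toAlgHom

theorem exists_aeval_eq_of_artinSchreier {F E : Type*} [Field F] [Field E]
    [Algebra F E] {y : E} (hgen : IntermediateField.adjoin F {y} = ⊤) {a : F}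
    (hy : y ^ p - y = algebraMap F E a) (z : E) :
    ∃ q : F[X], q.natDegree < p ∧ aeval y q = z := by
  have hp := (Fact.out : p.Prime)
  have hint : IsIntegral F y :=
    isIntegral_of_pow_sub_mul_eq hp.one_lt (c := 1) (e := a) (by rw [map_one, one_mul, hy])
  have hz : z ∈ Algebra.adjoin F {y} := by
    rw [(IntermediateField.adjoin_simple_eq_top_iff_of_isAlgebraic hint.isAlgebraic).1 hgen]
    trivial
  rw [Algebra.adjoin_singleton_eq_range_aeval] at hz
  obtain ⟨q, rfl⟩ := hz
  have hm := monic_X_pow_sub_C_mul_X_sub_C hp.one_lt 1 a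
  have hd := natDegree_X_pow_sub_C_mul_X_sub_C hp.one_lt 1 a
  refine ⟨q %ₘ (X ^ p - C 1 * X - C a), ?_, ?_⟩
  · have := natDegree_modByMonic_lt q hm (by
      intro h1
      rw [h1, natDegree_one] at hd
      exact hp.ne_zero hd.symm)
    rwa [hd] at this
  · exact aeval_modByMonic_eq_self_of_root (by simp [hy])

/-- The valuation of `E` at a maximal ideal above a discrete valuation ring `D`, for an
Artin-Schreier extension whose equation has a pole of order `h` prime to `p`. -/
theorem exists_valuation_of_artinSchreier {y : E} (hgen : IntermediateField.adjoin F {y} = ⊤)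
    {π d : D} (hπ : Irreducible π) (hd : IsUnit d) {h : ℕ} (hh1 : 1 ≤ h) (hh : ¬ p ∣ h)
    (hy : (y ^ p - y) * algebraMap D E (π ^ h) = algebraMap D E d)
    (P : Ideal (integralClosure D E)) [P.IsMaximal] :
    ∃ v : Valuation E ℤᵐ⁰, (∀ (c : integralClosure D E) (n : ℕ), v c ≤ exp (-(n : ℤ)) ↔ c ∈ P ^ n) ∧
      (∀ z, v z ≤ 1 → ∃ b s : integralClosure D E, v s = 1 ∧ z * s = b) ∧
      (∃ z : E, v z = exp (-1)) ∧ v y = exp (h : ℤ) ∧ v (algebraMap D E π) = exp (-(p : ℤ)) ∧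
      ∀ f : F, f ≠ 0 → ∃ n : ℤ, v (algebraMap F E f) = exp ((p : ℤ) * n) := by
  have hp := (Fact.out : p.Prime)
  have : CharP F p := charP_of_injective_algebraMap (IsFractionRing.injective D F) p
  have : CharP E p := charP_of_injective_algebraMap (algebraMap F E).injective p
  have hinj : Function.Injective (algebraMap D E) := by
    rw [IsScalarTower.algebraMap_eq D F E]
    exact (algebraMap F E).injective.comp (IsFractionRing.injective D F)
  have hπ0 : algebraMap D E π ≠ 0 := fun h0 => hπ.ne_zero (hinj (by rw [h0, map_zero]))
  have hya : y ^ p - y = algebraMap F E (algebraMap D F d / algebraMap D F (π ^ h)) := by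
    rw [map_div₀, ← IsScalarTower.algebraMap_apply, ← IsScalarTower.algebraMap_apply, eq_div_iff, hy]
    rw [map_pow]
    exact pow_ne_zero _ hπ0
  obtain ⟨_, _⟩ := finiteDimensional_and_isSeparable_of_artinSchreier hgen hya
  have : IsDedekindDomain (integralClosure D E) := integralClosure.isDedekindDomain D F E
  have : IsFractionRing (integralClosure D E) E :=
    integralClosure.isFractionRing_of_finite_extension F E
  have hPπ : algebraMap D (integralClosure D E) π ∈ P := by
    have h1 : P.under D = maximalIdeal D := eq_maximalIdeal (Ideal.IsMaximal.under D P)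
    have h2 : π ∈ P.under D := h1 ▸ (mem_maximalIdeal π).2 hπ.not_isUnit
    exact h2
  have hP0 : P ≠ ⊥ := by
    rintro rfl
    exact hπ0 (congrArg Subtype.val ((Submodule.mem_bot _).1 hPπ))
  set w : IsDedekindDomain.HeightOneSpectrum (integralClosure D E) := ⟨P, inferInstance, hP0⟩
  set v := w.valuation E
  have hvC : ∀ c : integralClosure D E, v c = w.intValuation c := fun c =>
    w.valuation_of_algebraMap c
  have hvle : ∀ c : integralClosure D E, v c ≤ 1 := fun c => w.valuation_le_one c
  have hvD : ∀ c : D, v (algebraMap D E c) ≤ 1 := fun c => hvle (algebraMap D _ c)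
  have hvu : ∀ c : D, IsUnit c → v (algebraMap D E c) = 1 := by
    intro c hc
    obtain ⟨c', hc'⟩ := hc.exists_right_inv
    refine le_antisymm (hvD c) ?_
    have h1 : v (algebraMap D E c) * v (algebraMap D E c') = 1 := by
      rw [← map_mul, ← map_mul, hc', map_one, map_one]
    rw [← h1]
    exact (mul_le_mul_right (hvD c') _).trans (mul_one _).le
  have hmem : ∀ (c : integralClosure D E) (n : ℕ), v c ≤ exp (-(n : ℤ)) ↔ c ∈ P ^ n := by
    intro c n
    rw [hvC]
    exact w.intValuation_le_pow_iff_mem c n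
  obtain ⟨e, he, hvπ⟩ : ∃ e : ℤ, 0 < e ∧ v (algebraMap D E π) = exp (-e) := by
    refine ⟨-log (v (algebraMap D E π)), ?_, ?_⟩
    · have h1 : v (algebraMap D E π) ≤ exp (-((1 : ℕ) : ℤ)) :=
        (hmem (algebraMap D _ π) 1).2 (by rwa [pow_one])
      have h2 := (log_le_log ((Valuation.ne_zero_iff v).2 hπ0) exp_ne_zero).2 h1
      rw [log_exp] at h2
      push_cast at h2
      omega
    · rw [neg_neg, exp_log ((Valuation.ne_zero_iff v).2 hπ0)]
  have hD : ∀ c : D, c ≠ 0 → ∃ n : ℕ, v (algebraMap D E c) = exp (-(e * n)) := by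
    intro c hc
    obtain ⟨n, u, rfl⟩ := IsDiscreteValuationRing.eq_unit_mul_pow_irreducible hc hπ
    refine ⟨n, ?_⟩
    rw [map_mul, map_mul, hvu _ u.isUnit, one_mul, map_pow, map_pow, hvπ, ← exp_nsmul, nsmul_eq_mul]
    congr 1
    ring
  have hF : ∀ f : F, f ≠ 0 → ∃ n : ℤ, v (algebraMap F E f) = exp (e * n) := by
    intro f hf
    obtain ⟨a, b, hb, rfl⟩ := IsFractionRing.div_surjective (A := D) f
    have ha : a ≠ 0 := by
      rintro rfl
      simp at hf
    obtain ⟨n, hn⟩ := hD a ha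
    obtain ⟨m, hm⟩ := hD b (nonZeroDivisors.ne_zero hb)
    refine ⟨m - n, ?_⟩
    rw [map_div₀, ← IsScalarTower.algebraMap_apply, ← IsScalarTower.algebraMap_apply, map_div₀,
      hn, hm, ← exp_sub]
    congr 1
    ring
  have hvy0 : v (y ^ p - y) = exp (e * h) := by
    have h1 := congrArg v hy
    rw [map_mul, hvu d hd, map_pow, map_pow, hvπ, ← exp_nsmul, nsmul_eq_mul] at h1
    rw [← mul_one (exp (e * h)), ← h1, mul_left_comm, ← exp_add]
    have : e * h + h * -e = 0 := by ring
    rw [this, exp_zero, mul_one]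
  have hy1 : 1 < v y := by
    by_contra hle
    rw [not_lt] at hle
    have h1 : v (y ^ p - y) ≤ 1 := (v.map_sub _ _).trans (max_le (by
      rw [map_pow]; exact pow_le_one₀ zero_le hle) hle)
    rw [hvy0, ← exp_zero, exp_le_exp] at h1
    have : 0 < e * h := mul_pos he (by omega)
    omega
  have hvyp : v y ^ p = exp (e * h) := by
    rw [← hvy0, ← map_pow]
    refine (v.map_sub_eq_of_lt_left ?_).symm
    rw [map_pow]
    exact lt_self_pow₀ hy1 hp.one_lt
  have hy0 : v y ≠ 0 := (zero_lt_one.trans hy1).ne'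
  have hlog : (p : ℤ) * log (v y) = e * h := by
    have h1 := congrArg log hvyp
    rwa [log_pow, log_exp, nsmul_eq_mul] at h1
  -- Comparing poles in `y ^ p - y` gives `p * log (v y) = e * h`, where `e` is the ramification
  -- index; so `h` prime to `p` forces `p ∣ e`.
  have hpe : (p : ℤ) ∣ e := by
    have h1 : (p : ℤ) ∣ e * h := ⟨_, hlog.symm⟩
    exact ((Nat.prime_iff_prime_int.1 hp).dvd_or_dvd h1).resolve_right (by exact_mod_cast hh)
  obtain ⟨e', rfl⟩ := hpe
  have hp0 : (0 : ℤ) < p := by exact_mod_cast hp.pos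
  have he' : 0 < e' := pos_of_mul_pos_right he hp0.le
  have hvy : v y = exp (e' * h) := by
    rw [← exp_log hy0]
    congr 1
    apply mul_left_cancel₀ hp0.ne'
    rw [hlog]; ring
  have hF' : ∀ f : F, f ≠ 0 → ∃ n : ℤ, v (algebraMap F E f) = exp (e' * (p * n)) := by
    intro f hf
    obtain ⟨n, hn⟩ := hF f hf
    exact ⟨n, by rw [hn]; congr 1; ring⟩
  obtain ⟨z, hz⟩ := w.valuation_exists_uniformizer E
  -- A uniformizer is a polynomial in `y`, so its valuation is that of one monomial and lies in the
  -- multiples of `e'`.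
  obtain rfl : e' = 1 := by
    obtain ⟨q, hq, rfl⟩ := exists_aeval_eq_of_artinSchreier (p := p) hgen hya z
    have hq0 : q ≠ 0 := by
      rintro rfl
      rw [map_zero, map_zero] at hz
      exact exp_ne_zero hz.symm
    obtain ⟨i, hi, hi', -⟩ := exists_valuation_aeval_eq hp he' hh hF' hvy hq0 hq
    obtain ⟨n, hn⟩ := hF' _ (mem_support_iff.1 hi)
    have h1 : w.valuation E = v := rfl
    rw [h1, hi', map_mul, map_pow, hn, hvy, ← exp_nsmul, ← exp_add, exp_inj, nsmul_eq_mul] at hz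
    have : e' ∣ 1 := ⟨-(p * n + h * i), by linear_combination hz⟩
    exact Int.eq_one_of_dvd_one he'.le this
  refine ⟨v, hmem, ?_, ⟨z, hz⟩, by rw [hvy, one_mul], by rw [hvπ, mul_one],
    by simpa only [one_mul] using hF'⟩
  intro x hx
  obtain ⟨b, s, hbs⟩ := w.exists_primeCompl_mul_eq_of_integer x hx
  refine ⟨b, s, ?_, hbs⟩
  rw [hvC]
  exact w.intValuation_eq_one_iff_mem_primeCompl s |>.2 s.2

end RamifiedExtension

end SurfaceRamification

/-! ### The ramification jump over a discrete valuation ring. -/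

namespace SurfaceRamification

open Polynomial WithZero IsLocalRing

theorem ramJump_eq_zero {D F E : Type*} [CommRing D] [Field F] [Algebra D F] [IsFractionRing D F]
    [Field E] [Algebra D E] [Algebra F E] [IsScalarTower D F E] {p : ℕ} [Fact p.Prime] [CharP D p]
    {y : E} (hgen : IntermediateField.adjoin F {y} = ⊤) {d : D}
    (hy : y ^ p - y = algebraMap D E d) : ramJump p D E = 0 := by
  have hp := (Fact.out : p.Prime)
  have : CharP F p := charP_of_injective_algebraMap (IsFractionRing.injective D F) p
  have hset : {i : ℕ | ∃ P : Ideal (integralClosure D E), P.IsMaximal ∧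
      P.ramificationIdx D = p ∧ Nat.card (lowerGroup D P i) = p} = ∅ := by
    rw [Set.eq_empty_iff_forall_notMem]
    rintro i ⟨P, hP, -, hi⟩
    rw [lowerGroup_eq_bot hgen hy P hP.ne_top, Subgroup.card_bot] at hi
    exact hp.one_lt.ne hi
  rw [ramJump, hset, csSup_empty]
  rfl

section RamifiedExtension

variable {D F E : Type*} [CommRing D] [IsDomain D] [IsDiscreteValuationRing D] [Field F]
  [Algebra D F] [IsFractionRing D F] [Field E] [Algebra D E] [Algebra F E] [IsScalarTower D F E]
  {p : ℕ} [Fact p.Prime] [CharP D p]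

theorem ramificationIdx_eq_of_mem_pow {π : D} (hπ : Irreducible π)
    [IsDedekindDomain (integralClosure D E)] (hinj : Function.Injective (algebraMap D E))
    (P : Ideal (integralClosure D E)) [P.IsMaximal] {n : ℕ}
    (h1 : algebraMap D (integralClosure D E) π ∈ P ^ n)
    (h2 : algebraMap D (integralClosure D E) π ∉ P ^ (n + 1)) : P.ramificationIdx D = n := by
  have hlo : P.LiesOver (maximalIdeal D) :=
    ⟨(eq_maximalIdeal (Ideal.IsMaximal.under D P)).symm⟩
  have hmap : (maximalIdeal D).map (algebraMap D (integralClosure D E)) =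
      Ideal.span {algebraMap D (integralClosure D E) π} := by
    rw [(IsDiscreteValuationRing.irreducible_iff_uniformizer π).1 hπ, Ideal.map_span,
      Set.image_singleton]
  rw [← Ideal.ramificationIdx'_eq_ramificationIdx' (maximalIdeal D) P]
  · refine Ideal.ramificationIdx'_spec ?_ ?_
    · rwa [hmap, Ideal.span_singleton_le_iff_mem]
    · rwa [hmap, Ideal.span_singleton_le_iff_mem]
  · rw [hmap, Ne, Ideal.span_singleton_eq_bot]
    intro h0
    exact hπ.ne_zero (hinj (by rw [map_zero]; exact congrArg Subtype.val h0))

/-- A generator `σ` moves every integral element by at most `exp (-(h + 1))`, and moves some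
monomial of size `exp (-1)` by exactly that much. So `G_i` is the whole group for `i ≤ h` and
trivial beyond. -/
theorem ramJump_eq_of_isUnit {y : E} (hgen : IntermediateField.adjoin F {y} = ⊤)
    {π d : D} (hπ : Irreducible π) (hd : IsUnit d) {h : ℕ} (hh1 : 1 ≤ h) (hh : ¬ p ∣ h)
    (hy : (y ^ p - y) * algebraMap D E (π ^ h) = algebraMap D E d) : ramJump p D E = h := by
  have hp := (Fact.out : p.Prime)
  have : CharP F p := charP_of_injective_algebraMap (IsFractionRing.injective D F) p
  have : CharP E p := charP_of_injective_algebraMap (algebraMap F E).injective p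
  have hinj : Function.Injective (algebraMap D E) := by
    rw [IsScalarTower.algebraMap_eq D F E]
    exact (algebraMap F E).injective.comp (IsFractionRing.injective D F)
  have hπ0 : algebraMap D E π ≠ 0 := fun h0 => hπ.ne_zero (hinj (by rw [h0, map_zero]))
  have hya : y ^ p - y = algebraMap F E (algebraMap D F d / algebraMap D F (π ^ h)) := by
    rw [map_div₀, ← IsScalarTower.algebraMap_apply, ← IsScalarTower.algebraMap_apply, eq_div_iff, hy]
    rw [map_pow]
    exact pow_ne_zero _ hπ0
  obtain ⟨_, _⟩ := finiteDimensional_and_isSeparable_of_artinSchreier hgen hya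
  have : IsDedekindDomain (integralClosure D E) := integralClosure.isDedekindDomain D F E
  have hval := fun (P : Ideal (integralClosure D E)) [P.IsMaximal] =>
    exists_valuation_of_artinSchreier hgen hπ hd hh1 hh hy P
  obtain ⟨P₀, hP₀⟩ := Ideal.exists_maximal (integralClosure D E)
  have hint : IsIntegral F y :=
    isIntegral_of_pow_sub_mul_eq hp.one_lt (c := 1)
      (e := algebraMap D F d / algebraMap D F (π ^ h)) (by rw [map_one, one_mul]; exact hya)
  have hmin : (minpoly F y).natDegree = p := by
    refine le_antisymm ?_ ?_
    · rw [← natDegree_X_pow_sub_C_mul_X_sub_C hp.one_lt 1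
        (algebraMap D F d / algebraMap D F (π ^ h))]
      refine natDegree_le_of_dvd (minpoly.dvd F y (by simp [hya])) ?_
      exact (monic_X_pow_sub_C_mul_X_sub_C hp.one_lt _ _).ne_zero
    -- A minimal polynomial of degree below `p` would have a value at `y` with the valuation of a
    -- nonzero monomial, yet that value is zero.
    · by_contra hlt
      rw [not_le] at hlt
      obtain ⟨v, -, -, -, hvy, -, hF⟩ := hval P₀
      obtain ⟨i, hi, hi', -⟩ := exists_valuation_aeval_eq hp one_pos hh
        (by simpa only [one_mul] using hF) (by rwa [one_mul]) (minpoly.ne_zero hint) hlt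
      obtain ⟨n, hn⟩ := hF _ (mem_support_iff.1 hi)
      rw [minpoly.aeval, map_zero, map_mul, hn, map_pow, hvy, ← exp_nsmul, ← exp_add] at hi'
      exact exp_ne_zero hi'.symm
  have hcard : Nat.card (E ≃ₐ[D] E) = p := (card_algEquiv_artinSchreier hgen hya hmin).2
  have hσp : ∀ σ : E ≃ₐ[D] E, (σ y - y) ^ p = σ y - y := by
    intro σ
    have h2 : σ (y ^ p - y) = y ^ p - y := by rw [hya, algEquiv_apply_algebraMap]
    rw [map_sub, map_pow] at h2
    rw [sub_pow_char]
    linear_combination h2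
  have hset : {i : ℕ | ∃ P : Ideal (integralClosure D E), P.IsMaximal ∧
      P.ramificationIdx D = p ∧ Nat.card (lowerGroup D P i) = p} = Set.Iic h := by
    ext i
    rw [Set.mem_ofPred_eq, Set.mem_Iic]
    constructor
    · rintro ⟨P, hP, -, hPi⟩
      by_contra hlt
      obtain ⟨v, hmem, hfrac, ⟨z, hz⟩, hvy, -, hF⟩ := hval P
      have hnt : Nontrivial (lowerGroup D P i) := by
        have := Nat.finite_of_card_ne_zero (hPi.symm ▸ hp.ne_zero)
        exact Finite.one_lt_card_iff_nontrivial.1 (hPi.symm ▸ hp.one_lt)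
      obtain ⟨⟨σ, hσ⟩, hσ1⟩ := exists_ne (1 : lowerGroup D P i)
      have hσ1' : σ ≠ 1 := fun h0 => hσ1 (Subtype.ext h0)
      have hsub : ∀ c : integralClosure D E, v (σ c - c) ≤ exp (-((h : ℤ) + 2)) := by
        intro c
        have h1 : σ • c - c ∈ P ^ (i + 1) := hσ c
        refine ((hmem _ _).2 h1).trans (exp_le_exp.2 ?_)
        push_cast
        omega
      have hζ0 : σ y - y ≠ 0 := fun h0 => hσ1' (algEquiv_eq_one hgen (sub_eq_zero.1 h0))
      have hζ := valuation_eq_one_of_pow_eq_self v hp.one_lt (hσp σ) hζ0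
      have hy1 : 1 < v y := by
        rw [hvy, ← exp_zero, exp_lt_exp]
        omega
      obtain ⟨q, hq, rfl⟩ := exists_aeval_eq_of_artinSchreier (p := p) hgen hya z
      have hq0 : q ≠ 0 := by
        rintro rfl
        rw [map_zero, map_zero] at hz
        exact exp_ne_zero hz.symm
      obtain ⟨j, hj, hj', -⟩ := exists_valuation_aeval_eq hp one_pos hh
        (by simpa only [one_mul] using hF) (by rwa [one_mul]) hq0 hq
      rw [hz] at hj'
      obtain ⟨n, hn⟩ := hF _ (mem_support_iff.1 hj)
      have hjp := (le_natDegree_of_mem_supp j hj).trans_lt hq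
      -- Elements of the base field have valuations divisible by `p`, so the monomial dominating the
      -- uniformizer does involve `y`.
      have hj0 : j ≠ 0 := by
        rintro rfl
        rw [pow_zero, mul_one, hn, exp_inj] at hj'
        have h1 : (p : ℤ) ∣ 1 := ⟨-n, by linear_combination -hj'⟩
        exact hp.one_lt.ne' (by exact_mod_cast Int.eq_one_of_dvd_one (by positivity) h1)
      obtain ⟨k, rfl⟩ := Nat.exists_eq_succ_of_ne_zero hj0
      have hpk : ¬ p ∣ k + 1 := fun hd => absurd (Nat.le_of_dvd (by omega) hd) (by omega)
      set c := algebraMap F E (q.coeff (k + 1))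
      have hexact : v (σ (c * y ^ (k + 1)) - c * y ^ (k + 1)) = exp (-((h : ℤ) + 1)) := by
        have h1 : σ (c * y ^ (k + 1)) - c * y ^ (k + 1) =
            c * ((y + (σ y - y)) ^ (k + 1) - y ^ (k + 1)) := by
          rw [map_mul, map_pow, algEquiv_apply_algebraMap, add_sub_cancel, mul_sub]
        rw [h1, map_mul, valuation_add_pow_sub_pow_eq hy1 hζ hpk]
        rw [map_mul, map_pow, pow_succ, ← mul_assoc, hvy] at hj'
        rw [hvy]
        refine mul_right_cancel₀ (b := exp (h : ℤ)) exp_ne_zero ?_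
        rw [← hj', ← exp_add]
        congr 1
        ring
      -- The monomial is integral at `P` but perhaps not at other primes, so it is written as `b /
      -- s` with `s` a unit at `P`; the bound on `σ` for `b` and `s` then contradicts `hexact`.
      obtain ⟨b, s, hs, hbs⟩ := hfrac (c * y ^ (k + 1)) (by
        rw [← hj', ← exp_zero, exp_le_exp]; omega)
      have hs0 : (s : E) ≠ 0 := fun h0 => by rw [h0, map_zero] at hs; exact zero_ne_one hs
      have hle1 : exp (-((h : ℤ) + 2)) < 1 := by
        rw [← exp_zero, exp_lt_exp]; omega
      have hσs : v (σ s) = 1 := by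
        rw [← hs]
        refine Valuation.map_eq_of_sub_lt v ?_
        rw [hs]
        exact (hsub s).trans_lt hle1
      have hzle : v (c * y ^ (k + 1)) ≤ 1 := by
        rw [← hj', ← exp_zero, exp_le_exp]; omega
      have hkey : (σ (c * y ^ (k + 1)) - c * y ^ (k + 1)) * σ s =
          (σ b - b) - c * y ^ (k + 1) * (σ s - s) := by
        rw [← hbs, map_mul σ _ (s : E)]
        ring
      have h3 := congrArg v hkey
      rw [map_mul, hσs, mul_one, hexact] at h3
      have h4 : v ((σ b - b) - c * y ^ (k + 1) * (σ s - s)) ≤ exp (-((h : ℤ) + 2)) := by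
        refine (v.map_sub _ _).trans (max_le (hsub b) ?_)
        rw [map_mul]
        exact (mul_le_mul' hzle (hsub s)).trans (one_mul _).le
      rw [← h3, exp_le_exp] at h4
      omega
    · intro hi
      obtain ⟨v, hmem, hfrac, -, hvy, hvπ, hF⟩ := hval P₀
      refine ⟨P₀, hP₀, ?_, ?_⟩
      · refine ramificationIdx_eq_of_mem_pow hπ hinj P₀ ((hmem _ _).1 hvπ.le) ?_
        rw [← hmem]
        change ¬ v (algebraMap D E π) ≤ _
        rw [hvπ, exp_le_exp]
        push_cast
        omega
      · have htop : lowerGroup D P₀ i = ⊤ := by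
          rw [eq_top_iff]
          rintro σ -
          intro c
          change σ • c - c ∈ P₀ ^ (i + 1)
          rw [← hmem]
          have hc1 : v c ≤ 1 := by
            have := (hmem c 0).2 (by simp)
            simpa using this
          obtain ⟨q, hq, hqc⟩ := exists_aeval_eq_of_artinSchreier (p := p) hgen hya (c : E)
          have h1 := valuation_algHom_sub_le hh hF hvy (algEquivFractionRing D F E σ).toAlgHom
            (hσp σ) hq (by rw [hqc]; exact hc1)
          rw [hqc] at h1
          refine h1.trans (exp_le_exp.2 ?_)
          push_cast
          omega
        rw [htop, Subgroup.card_top, hcard]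
  rw [ramJump, hset, csSup_Iic]

/-- The ramification jump of an Artin-Schreier extension of the fraction field of a discrete
valuation ring with perfect residue field is the smallest order of a pole among the Artin-Schreier
equations that are equivalent to the given one. -/
theorem ramJump_eq_sInf (hperf : ∀ d : D, ∃ γ : D, ¬ IsUnit (d - γ ^ p)) {y : E}
    (hgen : IntermediateField.adjoin F {y} = ⊤) {π e : D} (hπ : Irreducible π) {M : ℕ}
    (hy : (y ^ p - y) * algebraMap D E (π ^ M) = algebraMap D E e) :
    ramJump p D E = sInf {j : ℕ | ∃ γ : D,
      π ^ M ∣ π ^ j * (e - γ ^ p * π ^ (M % p) + γ * π ^ (M - M / p))} := by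
  have hp := (Fact.out : p.Prime)
  have : CharP F p := charP_of_injective_algebraMap (IsFractionRing.injective D F) p
  have : CharP E p := charP_of_injective_algebraMap (algebraMap F E).injective p
  have hinj : Function.Injective (algebraMap D E) := by
    rw [IsScalarTower.algebraMap_eq D F E]
    exact (algebraMap F E).injective.comp (IsFractionRing.injective D F)
  have hπ0 : algebraMap D E π ≠ 0 := fun h0 => hπ.ne_zero (hinj (by rw [h0, map_zero]))
  set S := {j : ℕ | ∃ γ : D,
      π ^ M ∣ π ^ j * (e - γ ^ p * π ^ (M % p) + γ * π ^ (M - M / p))} with hS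
  have hMS : M ∈ S := ⟨0, Dvd.intro _ rfl⟩
  have hhS : sInf S ∈ S := Nat.sInf_mem ⟨M, hMS⟩
  have hmin : ∀ j ∈ S, sInf S ≤ j := fun j hj => Nat.sInf_le hj
  set h := sInf S
  have hhM : h ≤ M := hmin M hMS
  obtain ⟨γ, hγ⟩ := hhS
  set n := M / p with hn
  have hnM : n ≤ M := Nat.div_le_self M p
  obtain ⟨r, hr⟩ := Nat.exists_eq_add_of_le hhM
  obtain ⟨d, hd⟩ : ∃ d, e - γ ^ p * π ^ (M % p) + γ * π ^ (M - n) = π ^ r * d := by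
    obtain ⟨d, hd⟩ := hγ
    refine ⟨d, mul_left_cancel₀ (pow_ne_zero h hπ.ne_zero) ?_⟩
    rw [hd, ← mul_assoc, ← pow_add, ← hr]
  -- Replacing `y` by `y - g` gives the numerator of `hd` over `π ^ M`. Poles of `g` up to order `M
  -- / p` are enough, and clearing them produces the exponents `M % p` and `M - M / p`.
  set g : F := algebraMap D F γ / algebraMap D F π ^ n with hg
  have hπF : algebraMap D F π ≠ 0 := fun h0 =>
    hπ.ne_zero (IsFractionRing.injective D F (by rw [h0, map_zero]))
  have hgn : algebraMap F E g * algebraMap D E π ^ n = algebraMap D E γ := by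
    rw [IsScalarTower.algebraMap_apply D F E, IsScalarTower.algebraMap_apply D F E γ, ← map_pow,
      ← map_mul, hg, div_mul_cancel₀ _ (pow_ne_zero _ hπF)]
  have hzgen : IntermediateField.adjoin F {y - algebraMap F E g} = ⊤ := by
    rw [eq_top_iff, ← hgen, IntermediateField.adjoin_simple_le_iff]
    have h1 := IntermediateField.mem_adjoin_simple_self F (y - algebraMap F E g)
    have h2 := IntermediateField.add_mem _ h1 (IntermediateField.algebraMap_mem
      (IntermediateField.adjoin F {y - algebraMap F E g}) g)
    rwa [sub_add_cancel] at h2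
  have hz : ((y - algebraMap F E g) ^ p - (y - algebraMap F E g)) * algebraMap D E (π ^ h) =
      algebraMap D E d := by
    have hgp : algebraMap F E g ^ p * algebraMap D E π ^ M =
        algebraMap D E γ ^ p * algebraMap D E π ^ (M % p) := by
      rw [← hgn, mul_pow, ← pow_mul, mul_assoc, ← pow_add, hn, mul_comm _ p, Nat.div_add_mod]
    have hg1 : algebraMap F E g * algebraMap D E π ^ M =
        algebraMap D E γ * algebraMap D E π ^ (M - n) := by
      rw [← hgn, mul_assoc, ← pow_add, Nat.add_sub_cancel' hnM]
    have hd' := congrArg (algebraMap D E) hd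
    simp only [map_mul, map_pow, map_add, map_sub] at hd' hy ⊢
    have hM : algebraMap D E π ^ M = algebraMap D E π ^ h * algebraMap D E π ^ r := by
      rw [← pow_add, ← hr]
    refine mul_right_cancel₀ (pow_ne_zero r hπ0) ?_
    rw [sub_pow_char]
    linear_combination hy - hgp + hg1 + hd' -
      (y ^ p - algebraMap F E g ^ p - (y - algebraMap F E g)) * hM
  by_cases hh0 : h = 0
  · rw [hh0]
    refine ramJump_eq_zero hzgen (d := d) ?_
    rw [← hz, hh0, pow_zero, map_one, mul_one]
  refine ramJump_eq_of_isUnit hzgen hπ ?_ (by omega) ?_ hz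
  -- A minimal pole order leaves no factor `π` in the numerator.
  · by_contra hdu
    have hdm : d ∈ maximalIdeal D := (mem_maximalIdeal d).2 hdu
    rw [(IsDiscreteValuationRing.irreducible_iff_uniformizer π).1 hπ,
      Ideal.mem_span_singleton] at hdm
    obtain ⟨d', rfl⟩ := hdm
    have : h - 1 ∈ S := by
      refine ⟨γ, d', ?_⟩
      rw [hd]
      obtain ⟨i, hi⟩ := Nat.exists_eq_succ_of_ne_zero hh0
      rw [hr, hi, Nat.succ_sub_one, Nat.succ_eq_add_one]
      ring
    have := hmin _ this
    omega
  · rintro ⟨k, hk⟩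
    -- If `h = p * k`, a `p`-th root of the leading coefficient in the residue field allows the
    -- subtraction of `γ₀ / π ^ k`, which lowers the pole and contradicts minimality.
    obtain ⟨γ₀, hγ₀⟩ := hperf d
    have hdm : d - γ₀ ^ p ∈ maximalIdeal D := (mem_maximalIdeal _).2 hγ₀
    rw [(IsDiscreteValuationRing.irreducible_iff_uniformizer π).1 hπ,
      Ideal.mem_span_singleton] at hdm
    obtain ⟨d', hd'⟩ := hdm
    have hkn : k ≤ n := by
      rw [hn, Nat.le_div_iff_mul_le hp.pos, mul_comm, ← hk]
      exact hhM
    obtain ⟨i, hi⟩ := Nat.exists_eq_add_of_le hkn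
    have hk0 : k ≠ 0 := by
      rintro rfl
      exact hh0 (by rw [hk, mul_zero])
    have hkh : k + 1 ≤ h := by
      have := Nat.mul_le_mul_right k hp.two_le
      omega
    obtain ⟨l, hl⟩ := Nat.exists_eq_add_of_le hkh
    have : h - 1 ∈ S := by
      refine ⟨γ + γ₀ * π ^ i, d' + γ₀ * π ^ l, ?_⟩
      have e1 : π ^ (i * p) * π ^ (M % p) = π ^ r := by
        rw [← pow_add]
        congr 1
        have h1 := Nat.div_add_mod M p
        rw [← hn, hi, mul_add, ← hk] at h1
        rw [mul_comm i p]
        omega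
      have e2 : π ^ i * π ^ (M - n) = π ^ r * (π ^ l * π) := by
        rw [← pow_add, ← pow_succ, ← pow_add]
        congr 1
        omega
      have hmain : e - (γ + γ₀ * π ^ i) ^ p * π ^ (M % p) + (γ + γ₀ * π ^ i) * π ^ (M - n) =
          π ^ r * π * (d' + γ₀ * π ^ l) := by
        rw [add_pow_char, mul_pow, ← pow_mul]
        linear_combination hd + π ^ r * hd' - γ₀ ^ p * e1 + γ₀ * e2
      rw [hmain, hr]
      obtain ⟨i', hi'⟩ := Nat.exists_eq_succ_of_ne_zero hh0
      rw [hi', Nat.succ_sub_one, Nat.succ_eq_add_one]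
      ring
    have := hmin _ this
    omega

end RamifiedExtension

end SurfaceRamification

/-! ### The jump along a curve on the surface. -/

namespace SurfaceRamification

open IsLocalRing

/-- The Artin-Schreier equation is restricted to the curve, where `Δ` becomes `π ^ M` times a unit,
and `ramJump_eq_sInf` is applied. The residue field extension is allowed to be any model `E` of the
fraction field. -/
theorem ramJump_quotient_eq_sInf {A K L : Type*} [CommRing A] [IsDomain A] [IsIntegrallyClosed A] [Field K]
    [Algebra A K] [IsFractionRing A K] [Field L] [Algebra K L] [Algebra A L] [IsScalarTower A K L]
    [FiniteDimensional K L] [Algebra.IsSeparable K L] {p : ℕ} [Fact p.Prime] [CharP A p]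
    (hdeg : Module.finrank K L = p) {x : L} (hx : IntermediateField.adjoin K {x} = ⊤) {w Δ : A}
    (hxw : (x ^ p - x) * algebraMap A L Δ = algebraMap A L w)
    (q : Ideal (integralClosure A L)) [q.IsPrime] [IsDiscreteValuationRing (A ⧸ q.under A)]
    (E : Type*) [Field E] [Algebra (integralClosure A L ⧸ q) E]
    [IsFractionRing (integralClosure A L ⧸ q) E] [Algebra (A ⧸ q.under A) E]
    [IsScalarTower (A ⧸ q.under A) (integralClosure A L ⧸ q) E]
    (hperf : ∀ d : A ⧸ q.under A, ∃ γ, ¬ IsUnit (d - γ ^ p)) (hΔ : Δ ∉ q.under A) {π e η : A}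
    (hπ : Irreducible (Ideal.Quotient.mk (q.under A) π)) {M : ℕ} (hη : IsUnit η)
    (hΔη : Δ - π ^ M * η ∈ q.under A) (he : e * η - w ∈ q.under A) :
    ramJump p (A ⧸ q.under A) E = sInf {j : ℕ | ∃ γ : A,
      π ^ j * (e - γ ^ p * π ^ (M % p) + γ * π ^ (M - M / p)) ∈
        q.under A ⊔ Ideal.span {π ^ M}} := by
  have hp := (Fact.out : p.Prime)
  have : CharP (A ⧸ q.under A) p := by
    rw [CharP.charP_iff_prime_eq_zero hp, ← map_natCast (Ideal.Quotient.mk (q.under A)),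
      CharP.cast_eq_zero, map_zero]
  have hDinj : Function.Injective (algebraMap (A ⧸ q.under A) E) := by
    rw [IsScalarTower.algebraMap_eq (A ⧸ q.under A) (integralClosure A L ⧸ q) E, RingHom.coe_comp]
    exact (IsFractionRing.injective _ _).comp (FaithfulSMul.algebraMap_injective _ _)
  have : FaithfulSMul (A ⧸ q.under A) E :=
    (faithfulSMul_iff_algebraMap_injective _ _).2 hDinj
  let F := FractionRing (A ⧸ q.under A)
  let : Algebra F E := FractionRing.liftAlgebra (A ⧸ q.under A) E
  set φ : integralClosure A L →+* E :=
    (algebraMap (integralClosure A L ⧸ q) _).comp (Ideal.Quotient.mk q) with hφ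
  have hφA : ∀ a : A, φ (algebraMap A _ a) =
      algebraMap (A ⧸ q.under A) _ (Ideal.Quotient.mk (q.under A) a) := fun a => by
    rw [IsScalarTower.algebraMap_apply (A ⧸ q.under A) (integralClosure A L ⧸ q) E]
    rfl
  set y₀ : L := algebraMap A L Δ * x
  have hy₀ := mul_pow_sub_pow_mul_mul hp.pos hxw
  have hy₀i : IsIntegral A y₀ := isIntegral_of_pow_sub_mul_eq hp.one_lt hy₀
  have hΔ0 : Δ ≠ 0 := by rintro rfl; exact hΔ (Ideal.zero_mem _)
  have hy₀K := adjoin_algebraMap_mul_eq_top (A := A) hx hΔ0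
  set Y : integralClosure A L := ⟨y₀, hy₀i⟩
  have hY : Y ^ p - algebraMap A _ (Δ ^ (p - 1)) * Y = algebraMap A _ (Δ ^ (p - 1) * w) :=
    Subtype.ext hy₀
  set δ := φ (algebraMap A _ Δ) with hδ
  have hδ0 : δ ≠ 0 := by
    rw [hδ, hφA]
    intro h0
    exact hΔ (Ideal.Quotient.eq_zero_iff_mem.1 (hDinj (by rw [h0, map_zero])))
  -- The residue of `x`: it is formed from the integral element `Δ * x`, since `x` itself need not
  -- be integral.
  set y := φ Y / δ with hyd
  have hyY : y * δ = φ Y := div_mul_cancel₀ _ hδ0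
  have hyw : (y ^ p - y) * δ = φ (algebraMap A _ w) := by
    have h1 := congrArg φ hY
    simp only [map_sub, map_mul, map_pow] at h1
    rw [← hyY] at h1
    obtain ⟨l, hl⟩ : ∃ l, p = l + 1 := ⟨p - 1, by have := hp.pos; omega⟩
    refine mul_left_cancel₀ (pow_ne_zero (p - 1) hδ0) ?_
    rw [← h1, hl, Nat.add_sub_cancel]
    ring
  have hye : (y ^ p - y) * algebraMap (A ⧸ q.under A) _ (Ideal.Quotient.mk (q.under A) π ^ M) =
      algebraMap (A ⧸ q.under A) _ (Ideal.Quotient.mk (q.under A) e) := by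
    have h1 := Ideal.Quotient.eq.2 hΔη
    have h2 := Ideal.Quotient.eq.2 he
    have h3 := hφA Δ
    rw [h1, map_mul, map_pow, map_mul] at h3
    have h4 := hφA w
    rw [← h2, map_mul, map_mul] at h4
    have hη' : algebraMap (A ⧸ q.under A) E
        (Ideal.Quotient.mk (q.under A) η) ≠ 0 :=
      ((hη.map (Ideal.Quotient.mk (q.under A))).map (algebraMap (A ⧸ q.under A)
        E)).ne_zero
    refine mul_right_cancel₀ hη' ?_
    rw [← h4, ← hyw, hδ, h3]
    ring
  have hgen : IntermediateField.adjoin F {y} = ⊤ := by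
    have hA : ∀ a : A, φ (algebraMap A _ a) ∈ IntermediateField.adjoin F {y} := by
      intro a
      rw [hφA, IsScalarTower.algebraMap_apply (A ⧸ q.under A) F]
      exact IntermediateField.algebraMap_mem _ _
    have hYm : φ Y ∈ IntermediateField.adjoin F {y} := by
      rw [← hyY]
      exact IntermediateField.mul_mem _ (IntermediateField.mem_adjoin_simple_self F y) (hA Δ)
    have hz : ∀ z ∈ Algebra.adjoin A {y₀}, ∃ hz : IsIntegral A z,
        φ ⟨z, hz⟩ ∈ IntermediateField.adjoin F {y} := by
      intro z hz
      induction hz using Algebra.adjoin_induction with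
      | mem z hz =>
        obtain rfl := hz
        exact ⟨hy₀i, hYm⟩
      | algebraMap r => exact ⟨isIntegral_algebraMap, hA r⟩
      | add z w _ _ hz hw =>
        obtain ⟨hz, hz'⟩ := hz
        obtain ⟨hw, hw'⟩ := hw
        refine ⟨hz.add hw, ?_⟩
        have : (⟨z + w, hz.add hw⟩ : integralClosure A L) = ⟨z, hz⟩ + ⟨w, hw⟩ := rfl
        rw [this, map_add]
        exact IntermediateField.add_mem _ hz' hw'
      | mul z w _ _ hz hw =>
        obtain ⟨hz, hz'⟩ := hz
        obtain ⟨hw, hw'⟩ := hw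
        refine ⟨hz.mul hw, ?_⟩
        have : (⟨z * w, hz.mul hw⟩ : integralClosure A L) = ⟨z, hz⟩ * ⟨w, hw⟩ := rfl
        rw [this, map_mul]
        exact IntermediateField.mul_mem _ hz' hw'
    -- A power of `Δ` carries the integral closure into `A[Δ * x]`, and `Δ` does not vanish on the
    -- curve.
    have hB : ∀ b : integralClosure A L, φ b ∈ IntermediateField.adjoin F {y} := by
      intro b
      obtain ⟨hi, hm⟩ := hz _ (pow_mul_mem_adjoin hdeg hy₀K hy₀ b.2)
      have : (⟨_, hi⟩ : integralClosure A L) = algebraMap A _ ((Δ ^ (p - 1)) ^ p) * b := rfl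
      rw [this, map_mul] at hm
      have h0 : φ (algebraMap A _ ((Δ ^ (p - 1)) ^ p)) ≠ 0 := by
        rw [map_pow, map_pow, map_pow, map_pow]
        exact pow_ne_zero _ (pow_ne_zero _ hδ0)
      have := IntermediateField.mul_mem _ (IntermediateField.inv_mem _
        (hA ((Δ ^ (p - 1)) ^ p))) hm
      rwa [inv_mul_cancel_left₀ h0] at this
    rw [eq_top_iff]
    rintro z -
    obtain ⟨b, c, -, rfl⟩ := IsFractionRing.div_surjective (A := integralClosure A L ⧸ q) z
    obtain ⟨b, rfl⟩ := Ideal.Quotient.mk_surjective b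
    obtain ⟨c, rfl⟩ := Ideal.Quotient.mk_surjective c
    exact IntermediateField.div_mem _ (hB b) (hB c)
  rw [ramJump_eq_sInf hperf hgen hπ hye]
  congr 1
  ext j
  constructor
  · rintro ⟨γ, hγ⟩
    obtain ⟨γ, rfl⟩ := Ideal.Quotient.mk_surjective γ
    refine ⟨γ, ?_⟩
    rw [sup_comm, ← Ideal.mem_quotient_iff_mem_sup, Ideal.map_span, Set.image_singleton,
      Ideal.mem_span_singleton]
    simpa using hγ
  · rintro ⟨γ, hγ⟩
    refine ⟨Ideal.Quotient.mk _ γ, ?_⟩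
    rw [sup_comm, ← Ideal.mem_quotient_iff_mem_sup, Ideal.map_span, Set.image_singleton,
      Ideal.mem_span_singleton] at hγ
    simpa using hγ

/-- On the right-hand side the curve occurs only through the ideal `P + (π ^ M)`, and `e` only
through its class modulo that ideal. This is what makes jumps along different curves comparable. -/
theorem jump_eq_sInf {A K L : Type*} [CommRing A] [IsLocalRing A] [IsDomain A] [IsIntegrallyClosed A] [Field K]
    [Algebra A K] [IsFractionRing A K] [Field L] [Algebra K L] [Algebra A L] [IsScalarTower A K L]
    [FiniteDimensional K L] [Algebra.IsSeparable K L] {p : ℕ} [Fact p.Prime] [CharP A p]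
    (hdeg : Module.finrank K L = p) {x : L} (hx : IntermediateField.adjoin K {x} = ⊤) {w Δ : A}
    (hxw : (x ^ p - x) * algebraMap A L Δ = algebraMap A L w)
    (q : Ideal (integralClosure A L)) [q.IsPrime] {P : Ideal A} (hq : q.under A = P) [P.IsPrime]
    [IsDiscreteValuationRing (A ⧸ P)]
    (hperf : ∀ d : A, ∃ γ, ¬ IsUnit (d - γ ^ p)) (hΔ : Δ ∉ P) {π e η : A}
    (hπ : Irreducible (Ideal.Quotient.mk P π)) {M : ℕ} (hη : IsUnit η)
    (hΔη : Δ - π ^ M * η ∈ P) (he : e * η - w ∈ P) :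
    jump A L p q = sInf {j : ℕ | ∃ γ : A,
      π ^ j * (e - γ ^ p * π ^ (M % p) + γ * π ^ (M - M / p)) ∈ P ⊔ Ideal.span {π ^ M}} := by
  subst hq
  refine ramJump_quotient_eq_sInf hdeg hx hxw q _ ?_ hΔ hπ hη hΔη he
  intro d
  obtain ⟨d, rfl⟩ := Ideal.Quotient.mk_surjective d
  obtain ⟨γ, hγ⟩ := hperf d
  refine ⟨Ideal.Quotient.mk _ γ, ?_⟩
  rw [← map_pow, ← map_sub]
  have := IsLocalHom.of_surjective (Ideal.Quotient.mk (q.under A)) Ideal.Quotient.mk_surjective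
  exact fun hu => hγ (isUnit_of_map_unit _ _ hu)

end SurfaceRamification

/-! ### Comparing two curves with high contact. -/

namespace SurfaceRamification

open IsLocalRing

theorem mem_sup_span_pow_iff {A : Type*} [CommRing A] {P : Ideal A} {π z : A} {n : ℕ} :
    z ∈ P ⊔ Ideal.span {π ^ n} ↔ Ideal.Quotient.mk P π ^ n ∣ Ideal.Quotient.mk P z := by
  rw [sup_comm, ← Ideal.mem_quotient_iff_mem_sup, Ideal.map_span,
    Set.image_singleton, Ideal.mem_span_singleton, map_pow]

theorem isDiscreteValuationRing_of_mem_jetSet {A : Type*} [CommRing A] {d : ℕ} {𝔟 : Fin d → Ideal A} {r : ℕ} {P : Ideal A}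
    [P.IsPrime] (hP : P ∈ jetSet 𝔟 r) : IsDiscreteValuationRing (A ⧸ P) := by
  have := hP.2.1
  exact isDiscreteValuationRing_of_isRegularLocalRing hP.1.2

theorem le_sup_span_pow_of_le_inter {A : Type*} [CommRing A] {P : Ideal A} [P.IsPrime]
    [IsDiscreteValuationRing (A ⧸ P)] {π f : A} {n : ℕ}
    (hπ : Irreducible (Ideal.Quotient.mk P π)) (h : (n : ℕ∞) ≤ inter P (Ideal.span {f})) :
    Ideal.span {f} ≤ P ⊔ Ideal.span {π ^ n} := by
  rw [Ideal.span_singleton_le_iff_mem, sup_comm, ← Ideal.mem_quotient_iff_mem_sup, Ideal.map_span,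
    Set.image_singleton, Ideal.mem_span_singleton, ← IsDiscreteValuationRing.addVal_le_iff_dvd,
    map_pow, IsDiscreteValuationRing.addVal_pow, IsDiscreteValuationRing.addVal_uniformizer hπ, nsmul_eq_mul, mul_one,
    ← Ring.ord_eq_addVal, ← inter_span_singleton]
  exact h

section Uniformizer

variable {A : Type*} [CommRing A] [IsLocalRing A] {P : Ideal A} [P.IsPrime]
  [IsDiscreteValuationRing (A ⧸ P)]

theorem exists_isUnit_sub_mem_of_inter_eq {π t : A} {n : ℕ}
    (hπ : Irreducible (Ideal.Quotient.mk P π)) (h : inter P (Ideal.span {t}) = n) :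
    ∃ ε, IsUnit ε ∧ t - π ^ n * ε ∈ P := by
  have hval : IsDiscreteValuationRing.addVal (A ⧸ P) (Ideal.Quotient.mk P t) =
      IsDiscreteValuationRing.addVal (A ⧸ P) (Ideal.Quotient.mk P π ^ n) := by
    rw [← Ring.ord_eq_addVal, ← inter_span_singleton, h,
      IsDiscreteValuationRing.addVal_pow, IsDiscreteValuationRing.addVal_uniformizer hπ, nsmul_eq_mul, mul_one]
  obtain ⟨u, hu⟩ := ((IsDiscreteValuationRing.addVal_eq_iff_associated _ _).1 hval).symm
  obtain ⟨ε, hε⟩ := Ideal.Quotient.mk_surjective (I := P) u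
  have := IsLocalHom.of_surjective (Ideal.Quotient.mk P) Ideal.Quotient.mk_surjective
  refine ⟨ε, isUnit_of_map_unit (Ideal.Quotient.mk P) ε (hε ▸ u.isUnit), ?_⟩
  rw [← Ideal.Quotient.eq_zero_iff_mem, map_sub, map_mul, map_pow, hε, hu, sub_self]

/-- Contact of order at least two means a common tangent: `π'` is a multiple of `π` modulo `P`,
hence modulo `P' + (π' ^ 2)`, and then `π' * unit` is a multiple of `π` on `P'`. -/
theorem irreducible_mk_of_le_sup {P' : Ideal A} [P'.IsPrime] [IsDiscreteValuationRing (A ⧸ P')]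
    {π π' : A} (hπ : Irreducible (Ideal.Quotient.mk P π))
    (hπ' : Irreducible (Ideal.Quotient.mk P' π')) {n : ℕ} (hn : 2 ≤ n)
    (h : P ≤ P' ⊔ Ideal.span {π' ^ n}) : Irreducible (Ideal.Quotient.mk P' π) := by
  have hloc := IsLocalHom.of_surjective (Ideal.Quotient.mk P) Ideal.Quotient.mk_surjective
  have hloc' := IsLocalHom.of_surjective (Ideal.Quotient.mk P') Ideal.Quotient.mk_surjective
  have hπm : ¬ IsUnit π := fun hu => hπ.not_isUnit (hu.map _)
  have hπm' : ¬ IsUnit π' := fun hu => hπ'.not_isUnit (hu.map _)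
  have h1 : Ideal.Quotient.mk P π ∣ Ideal.Quotient.mk P π' := by
    rw [← Ideal.mem_span_singleton, ← (IsDiscreteValuationRing.irreducible_iff_uniformizer _).1 hπ,
      mem_maximalIdeal]
    exact fun hu => hπm' (isUnit_of_map_unit _ _ hu)
  obtain ⟨u, hu⟩ := h1
  obtain ⟨u, rfl⟩ := Ideal.Quotient.mk_surjective u
  rw [← map_mul, Ideal.Quotient.eq] at hu
  obtain ⟨c, hc, z, hz, hcz⟩ := Submodule.mem_sup.1 (h hu)
  obtain ⟨z, rfl⟩ := Ideal.mem_span_singleton.1 hz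
  obtain ⟨k, rfl⟩ := Nat.exists_eq_add_of_le hn
  have hunit : IsUnit (1 - π' ^ (k + 1) * z) := by
    by_contra hnu
    have h2 : π' ^ (k + 1) * z ∈ maximalIdeal A :=
      Ideal.mul_mem_right _ _ (Ideal.pow_mem_of_mem _ ((mem_maximalIdeal _).2 hπm') _ (by omega))
    have h3 := Ideal.add_mem _ ((mem_maximalIdeal _).2 hnu) h2
    rw [sub_add_cancel] at h3
    exact (mem_maximalIdeal _).1 h3 isUnit_one
  have heq : Ideal.Quotient.mk P' π' * Ideal.Quotient.mk P' (1 - π' ^ (k + 1) * z) =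
      Ideal.Quotient.mk P' π * Ideal.Quotient.mk P' u := by
    rw [← map_mul, ← map_mul, Ideal.Quotient.eq]
    convert hc using 1
    linear_combination -hcz
  have hass : Associated (Ideal.Quotient.mk P' π')
      (Ideal.Quotient.mk P' π' * Ideal.Quotient.mk P' (1 - π' ^ (k + 1) * z)) :=
    (associated_mul_unit_right _ _ (hunit.map _))
  have hirr := hass.irreducible hπ'
  rw [heq] at hirr
  rcases hirr.isUnit_or_isUnit rfl with hu1 | hu1
  · exact absurd (isUnit_of_map_unit _ _ hu1) hπm
  · exact (associated_mul_unit_right _ _ hu1).symm.irreducible hirr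

end Uniformizer

section SufficientOrder

variable {A : Type*} [CommRing A] [IsDomain A] [IsRegularLocalRing A]

/-- With a common `π`, both curves have the same ideal `P + (π ^ M)`, and the numerators `e`
obtained from `w` by dividing by the unit parts of the branch equations agree modulo it. The two
infima in `jump_eq_sInf` are then over the same set. -/
theorem isSufficientOrder_sum (hdim : ringKrullDim A = 2)
    [IsAlgClosed (ResidueField A)] [IsIntegrallyClosed A] {K L : Type*} [Field K]
    [Algebra A K] [IsFractionRing A K] [Field L] [Algebra K L] [Algebra A L] [IsScalarTower A K L]
    [FiniteDimensional K L] [Algebra.IsSeparable K L] {p : ℕ} [Fact p.Prime] [CharP A p]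
    (hdeg : Module.finrank K L = p) {x : L} (hx : IntermediateField.adjoin K {x} = ⊤)
    {d : ℕ} (hd : 1 ≤ d) {t : Fin d → A} {m : Fin d → ℕ} (hm : ∀ i, 1 ≤ m i) {w : A}
    (hxw : (x ^ p - x) * algebraMap A L (∏ i, t i ^ m i) = algebraMap A L w) {r : ℕ} (hr : 1 ≤ r) :
    IsSufficientOrder L p (fun i => Ideal.span {t i}) r
      (∑ i : Fin d, (m i + 1) * (if (i : ℕ) = 0 then r else 1) - 1) := by
  have hp := (Fact.out : p.Prime)
  intro P hP P' hP' hX q q' _ _ hq hq'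
  set ρ : Fin d → ℕ := fun i => if (i : ℕ) = 0 then r else 1 with hρ
  set X := ∑ i : Fin d, (m i + 1) * ρ i with hXd
  set M := ∑ i : Fin d, m i * ρ i with hMd
  -- This is the reason for `m i + 1` in place of `m i`: precision `X` survives division by `π ^ ρ
  -- i` with at least `M` left.
  have hXM : ∀ i, M + ρ i ≤ X := by
    intro i
    have h1 : X = M + ∑ i, ρ i := by
      rw [hXd, hMd, ← Finset.sum_add_distrib]
      exact Finset.sum_congr rfl fun i _ => by ring
    rw [h1]
    have := Finset.single_le_sum (f := ρ) (fun i _ => Nat.zero_le _) (Finset.mem_univ i)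
    omega
  have hρ1 : ∀ i, 1 ≤ ρ i := fun i => by
    simp only [hρ]
    split_ifs <;> omega
  have hM1 : 1 ≤ M := by
    have h1 := Finset.single_le_sum (f := fun i => m i * ρ i) (fun i _ => Nat.zero_le _)
      (Finset.mem_univ (⟨0, hd⟩ : Fin d))
    exact (Nat.mul_le_mul (hm ⟨0, hd⟩) (hρ1 ⟨0, hd⟩)).trans h1
  have hX2 : 2 ≤ X := by
    have := hXM ⟨0, hd⟩
    have := hρ1 ⟨0, hd⟩
    omega
  have hMX : M ≤ X := (Nat.le_add_right _ _).trans (hXM ⟨0, hd⟩)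
  have hXle : (X : ℕ∞) ≤ inter P P' := by
    refine le_trans ?_ hX
    have : X = X - 1 + 1 := by omega
    rw [this]
    push_cast
    rfl
  have hPp : P.IsPrime := hP.1.1
  have hPp' : P'.IsPrime := hP'.1.1
  have hdvr := isDiscreteValuationRing_of_mem_jetSet hP
  have hdvr' := isDiscreteValuationRing_of_mem_jetSet hP'
  -- The algebraically closed residue field is used only here, to extract `p`-th roots of residues.
  have hperf : ∀ c : A, ∃ γ, ¬ IsUnit (c - γ ^ p) := by
    intro c
    obtain ⟨γ, hγ⟩ := IsAlgClosed.exists_pow_nat_eq (residue A c) hp.pos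
    obtain ⟨γ, rfl⟩ := residue_surjective γ
    refine ⟨γ, ?_⟩
    rw [← mem_nonunits_iff, ← mem_maximalIdeal, ← residue_eq_zero_iff, map_sub, map_pow, hγ,
      sub_self]
  obtain ⟨f, -, hf⟩ := hP.1.exists_eq_span hdim
  obtain ⟨f', -, hf'⟩ := hP'.1.exists_eq_span hdim
  obtain ⟨π, hπ⟩ := IsDiscreteValuationRing.exists_irreducible (A ⧸ P)
  obtain ⟨π, rfl⟩ := Ideal.Quotient.mk_surjective π
  obtain ⟨π', hπ'⟩ := IsDiscreteValuationRing.exists_irreducible (A ⧸ P')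
  obtain ⟨π', rfl⟩ := Ideal.Quotient.mk_surjective π'
  have hXle' : (X : ℕ∞) ≤ inter P' P := by rwa [inter, sup_comm, ← inter]
  have hle : P' ≤ P ⊔ Ideal.span {π ^ X} := by
    rw [hf'] at hXle ⊢
    exact le_sup_span_pow_of_le_inter hπ hXle
  have hπP' : Irreducible (Ideal.Quotient.mk P' π) := by
    refine irreducible_mk_of_le_sup hπ hπ' hX2 ?_
    have h1 := hXle'
    rw [hf] at h1 ⊢
    exact le_sup_span_pow_of_le_inter hπ' h1
  have hle' : P ≤ P' ⊔ Ideal.span {π ^ X} := by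
    have h1 := hXle'
    rw [hf] at h1 ⊢
    exact le_sup_span_pow_of_le_inter hπP' h1
  have hspan : Ideal.span {π ^ X} ≤ Ideal.span {π ^ M} :=
    (Ideal.span_singleton_le_span_singleton).2 (pow_dvd_pow π hMX)
  have hJ : P ⊔ Ideal.span {π ^ M} = P' ⊔ Ideal.span {π ^ M} := by
    refine le_antisymm (sup_le ?_ le_sup_right) (sup_le ?_ le_sup_right)
    · exact hle'.trans (sup_le_sup_left hspan _)
    · exact hle.trans (sup_le_sup_left hspan _)
  have hinter : ∀ i, inter P (Ideal.span {t i}) = (ρ i : ℕ) := fun i => by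
    rw [hP.2.2.2 i]
    simp only [hρ]
    split_ifs <;> simp
  have hinter' : ∀ i, inter P' (Ideal.span {t i}) = (ρ i : ℕ) := fun i => by
    rw [hP'.2.2.2 i]
    simp only [hρ]
    split_ifs <;> simp
  choose ε hεu hε using fun i => exists_isUnit_sub_mem_of_inter_eq hπ (hinter i)
  choose ε' hεu' hε' using fun i => exists_isUnit_sub_mem_of_inter_eq hπP' (hinter' i)
  -- The two factorisations of `t i` give a congruence for `π ^ ρ i * (ε i - ε' i)` modulo `π ^ X`
  -- on `P`, from which `π ^ ρ i` is cancelled.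
  have hεε : ∀ i, ε i - ε' i ∈ P ⊔ Ideal.span {π ^ M} := by
    intro i
    have h1 : π ^ ρ i * (ε i - ε' i) ∈ P ⊔ Ideal.span {π ^ X} := by
      have h2 : π ^ ρ i * (ε i - ε' i) = (t i - π ^ ρ i * ε' i) - (t i - π ^ ρ i * ε i) := by ring
      rw [h2]
      exact Ideal.sub_mem _ (hle (hε' i)) (Ideal.mem_sup_left (hε i))
    rw [mem_sup_span_pow_iff, map_mul, map_pow] at h1
    rw [mem_sup_span_pow_iff]
    obtain ⟨k, hk⟩ := Nat.exists_eq_add_of_le (hXM i)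
    rw [hk, add_right_comm, pow_add, mul_comm] at h1
    exact (pow_dvd_pow _ (Nat.le_add_right M k)).trans
      ((mul_dvd_mul_iff_left (pow_ne_zero _ hπ.ne_zero)).1 h1)
  have hprod : ∀ (Q : Ideal A) (δ : Fin d → A), (∀ i, t i - π ^ ρ i * δ i ∈ Q) →
      (∏ i, t i ^ m i) - π ^ M * ∏ i, δ i ^ m i ∈ Q := by
    intro Q δ hδ
    rw [← Ideal.Quotient.eq, map_prod, hMd, ← Finset.prod_pow_eq_pow_sum, ← Finset.prod_mul_distrib,
      map_prod]
    refine Finset.prod_congr rfl fun i _ => ?_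
    rw [map_pow, Ideal.Quotient.eq.2 (hδ i), ← map_pow, mul_pow, ← pow_mul, mul_comm (ρ i)]
  have hunit : IsUnit (∏ i, ε i ^ m i) :=
    IsUnit.prod_univ_iff.2 fun i => (hεu i).pow _
  have hunit' : IsUnit (∏ i, ε' i ^ m i) :=
    IsUnit.prod_univ_iff.2 fun i => (hεu' i).pow _
  have hηη : (∏ i, ε i ^ m i) - ∏ i, ε' i ^ m i ∈ P ⊔ Ideal.span {π ^ M} := by
    rw [← Ideal.Quotient.eq, map_prod, map_prod]
    refine Finset.prod_congr rfl fun i _ => ?_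
    rw [map_pow, map_pow, Ideal.Quotient.eq.2 (hεε i)]
  have hnot : ∀ (Q : Ideal A) [Q.IsPrime] (η : A), Irreducible (Ideal.Quotient.mk Q π) → IsUnit η →
      (∏ i, t i ^ m i) - π ^ M * η ∈ Q → ∏ i, t i ^ m i ∉ Q := by
    intro Q _ η hQπ hη hQ hmem
    have h1 : π ^ M * η ∈ Q := by
      have := Q.sub_mem hmem hQ
      rwa [sub_sub_cancel] at this
    rcases Ideal.IsPrime.mem_or_mem ‹_› h1 with h2 | h2
    · exact hQπ.ne_zero (Ideal.Quotient.eq_zero_iff_mem.2 (Ideal.IsPrime.mem_of_pow_mem ‹_› _ h2))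
    · exact Ideal.IsPrime.ne_top ‹_› (Ideal.eq_top_of_isUnit_mem _ h2 hη)
  obtain ⟨θ, hθ⟩ := hunit.exists_left_inv
  obtain ⟨θ', hθ'⟩ := hunit'.exists_left_inv
  set η := ∏ i, ε i ^ m i
  set η' := ∏ i, ε' i ^ m i
  have hee : w * θ - w * θ' ∈ P ⊔ Ideal.span {π ^ M} := by
    have h1 : w * θ - w * θ' = -(w * θ * θ') * (η - η') := by
      linear_combination w * θ' * hθ - w * θ * hθ'
    rw [h1]
    exact Ideal.mul_mem_left _ _ hηη
  rw [jump_eq_sInf hdeg hx hxw q hq hperf (hnot P η hπ hunit (hprod P ε hε)) hπ hunit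
      (hprod P ε hε) (e := w * θ) (by rw [mul_assoc, hθ, mul_one, sub_self]; exact P.zero_mem),
    jump_eq_sInf hdeg hx hxw q' hq' hperf (hnot P' η' hπP' hunit' (hprod P' ε' hε')) hπP' hunit'
      (hprod P' ε' hε') (e := w * θ') (by rw [mul_assoc, hθ', mul_one, sub_self]; exact P'.zero_mem),
    ← hJ]
  congr 1
  ext j
  refine exists_congr fun γ => ?_
  have hdiff := Ideal.mul_mem_left _ (π ^ j) hee
  constructor
  · intro h
    convert Ideal.sub_mem _ h hdiff using 1
    ring
  · intro h
    convert Ideal.add_mem _ h hdiff using 1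
    ring

end SufficientOrder

end SurfaceRamification

/-! ### Generators, pole orders and the normalised equation. -/

namespace SurfaceRamification

/-- Additive Hilbert 90 by nilpotence: `N = σ - 1` satisfies `N ^ p = σ ^ p - 1 = 0`. A vector just
before the end of a Jordan chain, divided by the fixed vector that follows it, satisfies `σ x = x +
1`. -/
theorem exists_artinSchreier_generator {K L : Type*} [Field K] [Field L] [Algebra K L]
    [FiniteDimensional K L] [IsGalois K L] {p : ℕ} [Fact p.Prime] [CharP K p]
    (hdeg : Module.finrank K L = p) :
    ∃ (x : L) (a : K), IntermediateField.adjoin K {x} = ⊤ ∧ x ^ p - x = algebraMap K L a := by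
  have hp := (Fact.out : p.Prime)
  have : CharP L p := charP_of_injective_algebraMap (algebraMap K L).injective p
  have hcard : Nat.card Gal(L/K) = p := by rw [IsGalois.card_aut_eq_finrank, hdeg]
  have : Nontrivial Gal(L/K) := by
    rw [← Finite.one_lt_card_iff_nontrivial, hcard]
    exact hp.one_lt
  obtain ⟨σ, hσ⟩ := exists_ne (1 : Gal(L/K))
  have hfix : ∀ z : L, σ z = z → ∃ c, algebraMap K L c = z := by
    intro z hz
    refine (IsGalois.mem_range_algebraMap_iff_fixed z).2 fun τ => ?_
    have hτ : τ ∈ Subgroup.zpowers σ := mem_zpowers_of_prime_card hcard hσ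
    have hle : Subgroup.zpowers σ ≤ MulAction.stabilizer Gal(L/K) z :=
      Subgroup.zpowers_le.2 (MulAction.mem_stabilizer_iff.2 hz)
    exact MulAction.mem_stabilizer_iff.1 (hle hτ)
  set N : Module.End K L := σ.toLinearMap - 1
  have hN : ∀ z, N z = σ z - z := fun z => rfl
  have : CharP (Module.End K L) p :=
    charP_of_injective_algebraMap (FaithfulSMul.algebraMap_injective K (Module.End K L)) p
  have hNp : N ^ p = 0 := by
    have h1 : σ.toLinearMap ^ p = 1 := by
      ext z
      have h2 : σ ^ p = 1 := hcard ▸ pow_card_eq_one'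
      have h3 : ∀ n : ℕ, (σ.toLinearMap ^ n) z = (σ ^ n) z := by
        intro n
        induction n with
        | zero => rfl
        | succ n ih => rw [pow_succ', pow_succ', Module.End.mul_apply, ih]; rfl
      rw [h3, h2]; rfl
    rw [sub_pow_char_of_commute _ (Commute.one_right _), h1, one_pow, sub_self]
  have hex : ∃ n, N ^ n = 0 := ⟨p, hNp⟩
  classical
  have hN0 : N ≠ 0 := fun h0 => hσ (AlgEquiv.ext fun z => by
    have := hN z
    rw [h0, LinearMap.zero_apply] at this
    exact (sub_eq_zero.1 this.symm))
  obtain ⟨n, hn⟩ : ∃ n, Nat.find hex = n + 2 := by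
    refine ⟨Nat.find hex - 2, ?_⟩
    have h0 := Nat.find_spec hex
    have h1 : Nat.find hex ≠ 0 := fun h => by rw [h, pow_zero] at h0; exact one_ne_zero h0
    have h2 : Nat.find hex ≠ 1 := fun h => by rw [h, pow_one] at h0; exact hN0 h0
    omega
  have h0 : N ^ (n + 2) = 0 := hn ▸ Nat.find_spec hex
  have h1 : N ^ (n + 1) ≠ 0 := Nat.find_min hex (by omega)
  obtain ⟨z, hz⟩ : ∃ z, (N ^ (n + 1)) z ≠ 0 := by
    by_contra! hall
    exact h1 (LinearMap.ext hall)
  have h2 : N ((N ^ (n + 1)) z) = 0 := by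
    rw [← Module.End.mul_apply, ← pow_succ', h0, LinearMap.zero_apply]
  have h3 : N ((N ^ n) z) = (N ^ (n + 1)) z := by
    rw [← Module.End.mul_apply, ← pow_succ']
  obtain ⟨c, hc⟩ := hfix _ (sub_eq_zero.1 h2)
  rw [← hc] at hz
  set x : L := (N ^ n) z / algebraMap K L c
  have hx : σ x = x + 1 := by
    have h4 : σ ((N ^ n) z) = (N ^ n) z + algebraMap K L c := by
      rw [hc, ← h3, hN]; ring
    rw [map_div₀, AlgEquiv.commutes, h4, add_div, div_self hz]
  obtain ⟨a, ha⟩ := hfix (x ^ p - x) (by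
    rw [map_sub, map_pow, hx, add_pow_char, one_pow]; ring)
  refine ⟨x, a, ?_, ha.symm⟩
  -- There are no proper intermediate fields in prime degree, and `σ` moves `x`, so `x` generates.
  have hsimple : IsSimpleOrder (IntermediateField K L) :=
    IntermediateField.isSimpleOrder_of_finrank_prime K L (hdeg ▸ hp)
  refine (eq_bot_or_eq_top _).resolve_left fun hbot => ?_
  have hmem := IntermediateField.mem_adjoin_simple_self K x
  rw [hbot, IntermediateField.mem_bot] at hmem
  obtain ⟨y, hy⟩ := hmem
  have := σ.commutes y
  rw [hy, hx, add_eq_left] at this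
  exact one_ne_zero this

theorem ord_localization_span_singleton {A : Type*} [CommRing A] [IsDomain A] {t : A}
    (ht : Prime t) [(Ideal.span {t}).IsPrime] {f : A} (hf : ¬ t ∣ f) (n : ℕ) :
    Ring.ord (Localization.AtPrime (Ideal.span {t}))
      (algebraMap A (Localization.AtPrime (Ideal.span {t})) (t ^ n * f)) = n := by
  set S := Localization.AtPrime (Ideal.span {t})
  have hinj : Function.Injective (algebraMap A S) := IsLocalization.injective S
    (Ideal.primeCompl_le_nonZeroDivisors (Ideal.span {t}))
  have hdom : IsDomain S := IsLocalization.isDomain_of_le_nonZeroDivisors S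
    (Ideal.primeCompl_le_nonZeroDivisors (Ideal.span {t}))
  have hu : IsUnit (algebraMap A S f) :=
    (IsLocalization.AtPrime.isUnit_to_map_iff S (Ideal.span {t}) f).2
      fun h => hf (Ideal.mem_span_singleton.1 h)
  have ht0 : algebraMap A S t ≠ 0 := fun h => ht.ne_zero (hinj (by rw [h, map_zero]))
  have h1 : Ring.ord S (algebraMap A S t) = 1 := by
    have hmax : (Ideal.span {algebraMap A S t}).IsMaximal := by
      rw [← Set.image_singleton, ← Ideal.map_span, Localization.AtPrime.map_eq_maximalIdeal]
      infer_instance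
    rw [Ring.ord, Module.length_eq_one_iff,
      isSimpleModule_iff_isSimpleModule_of_algebraMap_surjective
        (S := S ⧸ Ideal.span {algebraMap A S t}) Ideal.Quotient.mk_surjective]
    let := Ideal.Quotient.field (Ideal.span {algebraMap A S t})
    exact instIsSimpleModule _
  rw [map_mul, map_pow, Ring.ord_mul_of_isUnit_right hu,
    Ring.ord_pow (mem_nonZeroDivisors_of_ne_zero ht0), h1, nsmul_eq_mul, mul_one]

theorem exists_primeVal_eq {A : Type*} [CommRing A] [IsDomain A] [WfDvdMonoid A] {K : Type*}
    [Field K] [Algebra A K] [IsFractionRing A K] {t : A} (ht : Prime t) [(Ideal.span {t}).IsPrime]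
    {a : K} (ha : a ≠ 0) :
    ∃ (i j : ℕ) (f g : A), ¬ t ∣ f ∧ ¬ t ∣ g ∧
      a * algebraMap A K (t ^ j * g) = algebraMap A K (t ^ i * f) ∧
      primeVal (Ideal.span {t}) a = i - j := by
  have hs := IsLocalization.sec_spec (nonZeroDivisors A) a
  have hg0 := nonZeroDivisors.ne_zero (IsLocalization.sec (nonZeroDivisors A) a).2.2
  have hf0 : (IsLocalization.sec (nonZeroDivisors A) a).1 ≠ 0 := by
    intro h0
    rw [h0, map_zero, mul_eq_zero] at hs
    exact hs.elim ha fun h => hg0 (IsFractionRing.injective A K (by rw [h, map_zero]))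
  obtain ⟨i, f, hf, hi⟩ := WfDvdMonoid.max_power_factor hf0 ht.irreducible
  obtain ⟨j, g, hg, hj⟩ := WfDvdMonoid.max_power_factor hg0 ht.irreducible
  refine ⟨i, j, f, g, hf, hg, by rw [← hi, ← hj, hs], ?_⟩
  rw [primeVal, hi, hj, ord_localization_span_singleton ht hf, ord_localization_span_singleton ht hg]
  rfl

theorem adjoin_add_algebraMap_eq_top {K L : Type*} [Field K] [Field L] [Algebra K L] {x : L}
    (hx : IntermediateField.adjoin K {x} = ⊤) (G : K) :
    IntermediateField.adjoin K {x + algebraMap K L G} = ⊤ := by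
  rw [eq_top_iff, ← hx, IntermediateField.adjoin_simple_le_iff]
  have h := sub_mem (IntermediateField.mem_adjoin_simple_self K (x + algebraMap K L G))
    (IntermediateField.algebraMap_mem (IntermediateField.adjoin K {x + algebraMap K L G}) G)
  rwa [add_sub_cancel_right] at h

theorem add_algebraMap_pow_sub_mul {A K L : Type*} [CommRing A] [Field K] [Algebra A K]
    [IsFractionRing A K] [Field L] [Algebra K L] [Algebra A L] [IsScalarTower A K L] {p : ℕ}
    [Fact p.Prime] [CharP A p] {x : L} {a : K} (hxa : x ^ p - x = algebraMap K L a) (G : K)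
    {g f : A} (h : (a + G ^ p - G) * algebraMap A K g = algebraMap A K f) :
    ((x + algebraMap K L G) ^ p - (x + algebraMap K L G)) * algebraMap A L g =
      algebraMap A L f := by
  have : CharP K p := charP_of_injective_algebraMap (IsFractionRing.injective A K) p
  have : CharP L p := charP_of_injective_algebraMap (algebraMap K L).injective p
  rw [IsScalarTower.algebraMap_apply A K L f, ← h, map_mul, ← IsScalarTower.algebraMap_apply A K L,
    map_sub, map_add, map_pow, ← hxa, add_pow_char]
  ring

section Branch

variable {A K L : Type*} [CommRing A] [IsDomain A]
  [UniqueFactorizationMonoid A] [Field K] [Algebra A K] [IsFractionRing A K]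
  [Field L] [Algebra K L] [Algebra A L] [IsScalarTower A K L]
  [FiniteDimensional K L] [Algebra.IsSeparable K L] {p : ℕ} [Fact p.Prime] [CharP A p]

/-- Without a pole along `t`, a denominator of `a` prime to `t` would make the extension unramified
over `t`. So every choice of `a` has a pole of positive order on each branch component. -/
theorem exists_pole_of_mem_branchPrimes (hdeg : Module.finrank K L = p) {x : L} {a : K}
    (hx : IntermediateField.adjoin K {x} = ⊤) (hxa : x ^ p - x = algebraMap K L a) {t : A}
    (ht : Prime t) [(Ideal.span {t}).IsPrime] (hbr : Ideal.span {t} ∈ branchPrimes A L) :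
    ∃ (m : ℕ) (f g : A), 1 ≤ m ∧ ¬ t ∣ g ∧ a * algebraMap A K (t ^ m * g) = algebraMap A K f ∧
      -primeVal (Ideal.span {t}) a = m := by
  obtain ⟨-, q, hq, hqt, hram⟩ := hbr
  have key : ∀ f g : A, ¬ t ∣ g → a * algebraMap A K g ≠ algebraMap A K f := by
    intro f g hg h
    refine hram (formallyUnramified_of_artinSchreier hdeg hx (f := f) (g := g) ?_ q ?_
      (Localization.AtPrime q))
    · rw [hxa, IsScalarTower.algebraMap_apply A K L, ← map_mul, h,
        ← IsScalarTower.algebraMap_apply]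
    · rw [hqt, Ideal.mem_span_singleton]
      exact hg
  have ha : a ≠ 0 := by
    rintro rfl
    exact key 0 1 (fun h => ht.not_isUnit (isUnit_of_dvd_one h)) (by rw [map_zero, zero_mul])
  obtain ⟨i, j, f, g, hf, hg, h, hv⟩ := exists_primeVal_eq ht ha
  have hpow : algebraMap A K t ≠ 0 := fun h0 =>
    ht.ne_zero (IsFractionRing.injective A K (by rw [h0, map_zero]))
  have hij : i < j := by
    by_contra! hji
    obtain ⟨k, rfl⟩ := Nat.exists_eq_add_of_le hji
    refine key (t ^ k * f) g hg (mul_left_cancel₀ (pow_ne_zero j hpow) ?_)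
    simp only [map_mul, map_pow, pow_add] at h ⊢
    linear_combination h
  obtain ⟨k, rfl⟩ := Nat.exists_eq_add_of_lt hij
  refine ⟨k + 1, f, g, by omega, hg, mul_left_cancel₀ (pow_ne_zero i hpow) ?_, ?_⟩
  · simp only [map_mul, map_pow, pow_add] at h ⊢
    linear_combination h
  · rw [hv]; push_cast; ring

/-- Every prime `h` not dividing `T` lies off the branch divisor, so a prime above it is unramified
and supplies the `p`-th power needed to remove the pole. -/
theorem exists_add_pow_sub_mul_pow_eq [IsRegularLocalRing A] (hdim : ringKrullDim A = 2) {x : L} {a : K}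
    (hxa : x ^ p - x = algebraMap K L a) {T : A} (hT0 : T ≠ 0) (hT : ¬ IsUnit T)
    (hbr : ∀ h : A, Prime h → Ideal.span {h} ∈ branchPrimes A L → h ∣ T) :
    ∃ (G : K) (M : ℕ) (w : A), (a + G ^ p - G) * algebraMap A K (T ^ M) = algebraMap A K w := by
  refine exists_mul_pow_eq_algebraMap hT0
    (fun h γ hh _ hγ => exists_dvd_pow_sub_mul hdim hh hT hγ) ?_
  intro h hh hhT G n f u hn hf hu heq
  have hprime : (Ideal.span {h}).IsPrime := (Ideal.span_singleton_prime hh.ne_zero).2 hh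
  have hinj : Function.Injective (algebraMap A L) := by
    rw [IsScalarTower.algebraMap_eq A K L]
    exact (algebraMap K L).injective.comp (IsFractionRing.injective A K)
  have : FaithfulSMul A (integralClosure A L) :=
    (faithfulSMul_iff_algebraMap_injective _ _).2 fun y z hyz => hinj (congrArg Subtype.val hyz)
  obtain ⟨q, hq, hqh⟩ := Ideal.exists_ideal_over_prime_of_isIntegral_of_isDomain
    (S := integralClosure A L) (Ideal.span {h}) (by
      rw [(RingHom.injective_iff_ker_eq_bot _).1
        (FaithfulSMul.algebraMap_injective A (integralClosure A L))]
      exact bot_le)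
  have hunr : Algebra.IsUnramifiedAt A q := by
    by_contra hram
    exact hhT (hbr h hh ⟨isPrimeDivisor_span hdim hh, q, hq, hqh, hram⟩)
  exact exists_pow_of_isUnramifiedAt (K := K) hh hn hf hu (add_algebraMap_pow_sub_mul hxa G heq) q hqh

end Branch

theorem irreducible_mk_of_inter_eq_one {A : Type*} [CommRing A] {P : Ideal A} [P.IsPrime]
    [IsDiscreteValuationRing (A ⧸ P)] {t : A} (h : inter P (Ideal.span {t}) = 1) :
    Irreducible (Ideal.Quotient.mk P t) := by
  obtain ⟨π, hπ⟩ := IsDiscreteValuationRing.exists_irreducible (A ⧸ P)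
  refine Associated.irreducible ((IsDiscreteValuationRing.addVal_eq_iff_associated _ _).1 ?_) hπ
  rw [IsDiscreteValuationRing.addVal_uniformizer hπ, ← Ring.ord_eq_addVal, ← inter_span_singleton,
    h]

/-- After a change of the Artin-Schreier generator, the element `a` has no poles outside of the
branch divisor, and its poles along the components of that divisor do not get worse. -/
theorem exists_add_pow_sub_mul_prod_eq {A K : Type*} [CommRing A] [IsDomain A]
    [UniqueFactorizationMonoid A] [Field K] [Algebra A K] [IsFractionRing A K] {p : ℕ}
    [Fact p.Prime] [CharP A p] {d : ℕ} (hd₁ : 1 ≤ d) (hd₂ : d ≤ 2) {t : Fin d → A}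
    (ht : ∀ i, Prime (t i)) [∀ i, (Ideal.span {t i}).IsPrime]
    [∀ i, IsDiscreteValuationRing (A ⧸ Ideal.span {t i})]
    (hcross : ∀ i j, i ≠ j → inter (Ideal.span {t i}) (Ideal.span {t j}) = 1) {a : K}
    {m : Fin d → ℕ} {f g : Fin d → A} (hg : ∀ i, ¬ t i ∣ g i)
    (ha : ∀ i, a * algebraMap A K (t i ^ m i * g i) = algebraMap A K (f i))
    (hT : ∃ (G : K) (M : ℕ) (w : A),
      (a + G ^ p - G) * algebraMap A K ((∏ i, t i) ^ M) = algebraMap A K w) :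
    ∃ (G : K) (w : A),
      (a + G ^ p - G) * algebraMap A K (∏ i, t i ^ m i) = algebraMap A K w := by
  obtain ⟨G, M, w, hw⟩ := hT
  obtain rfl | rfl : d = 1 ∨ d = 2 := by omega
  -- With one component the second exponent is `0`, and any uniformizer of the curve serves as
  -- second parameter.
  · obtain ⟨τ, hτ⟩ := IsDiscreteValuationRing.exists_irreducible (A ⧸ Ideal.span {t 0})
    obtain ⟨τ, rfl⟩ := Ideal.Quotient.mk_surjective τ
    rw [Fin.prod_univ_one] at hw
    obtain ⟨G, w, hw⟩ := exists_reduce_pole (n₂ := 0) (ht 0) hτ (hg 0) (ha 0) M G w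
      (by rwa [pow_zero, mul_one])
    exact ⟨G, w, by rwa [pow_zero, mul_one, ← Fin.prod_univ_one fun i => t i ^ m i] at hw⟩
  · have h01 : (0 : Fin 2) ≠ 1 := by decide
    rw [Fin.prod_univ_two, mul_pow] at hw
    obtain ⟨G, w, hw⟩ := exists_reduce_pole (ht 0)
      (irreducible_mk_of_inter_eq_one (hcross 0 1 h01)) (hg 0) (ha 0) M G w hw
    -- The first reduction kept the exponent along `t 1`, so the second may exchange the roles and
    -- keep `m 0`.
    rw [mul_comm] at hw
    obtain ⟨G, w, hw⟩ := exists_reduce_pole (ht 1)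
      (irreducible_mk_of_inter_eq_one (hcross 1 0 h01.symm)) (hg 1) (ha 1) M G w
      (by rwa [mul_comm (_ ^ _) (_ ^ _), mul_comm _ (algebraMap A K _)])
    exact ⟨G, w, by rwa [Fin.prod_univ_two, mul_comm (t 0 ^ m 0)]⟩

end SurfaceRamification

theorem theorem1
    (p : ℕ) [Fact p.Prime]
    {A : Type*} [CommRing A] [IsRegularLocalRing A] (hdim : ringKrullDim A = 2) [CharP A p]
    [IsAlgClosed (IsLocalRing.ResidueField A)]
    {K : Type*} [Field K] [Algebra A K] [IsFractionRing A K]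
    {L : Type*} [Field L] [Algebra K L] [Algebra A L] [IsScalarTower A K L]
    [IsGalois K L] (hdeg : Module.finrank K L = p)
    (d : ℕ) (hd₁ : 1 ≤ d) (hd₂ : d ≤ 2)
    (𝔟 : Fin d → Ideal A) [∀ i, (𝔟 i).IsPrime] (h𝔟_inj : Function.Injective 𝔟)
    (h𝔟_branch : Set.range 𝔟 = SurfaceRamification.branchPrimes A L)
    (h𝔟_reg : ∀ i, IsRegularLocalRing (A ⧸ 𝔟 i))
    (h𝔟_cross : ∀ i j, i ≠ j → SurfaceRamification.inter (𝔟 i) (𝔟 j) = 1) :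
    (∀ r : ℕ, 1 ≤ r → ∃ s : ℕ, SurfaceRamification.IsSufficientOrder L p 𝔟 r s) ∧
    (∃ N : ℕ, 1 ≤ N ∧ ∀ r : ℕ, 1 ≤ r → SurfaceRamification.su L p 𝔟 r < N * r) ∧
    (∀ (x : L) (a : K), IntermediateField.adjoin K {x} = ⊤ → x ^ p - x = algebraMap K L a →
      ∀ r : ℕ, 1 ≤ r →
        (SurfaceRamification.su L p 𝔟 r : ℤ) + 1 ≤
            ∑ i : Fin d, (-SurfaceRamification.primeVal (𝔟 i) a + 1) *
              (if (i : ℕ) = 0 then (r : ℤ) else 1) ∧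
        (SurfaceRamification.su L p 𝔟 r : ℤ) <
            (∑ i : Fin d, (-SurfaceRamification.primeVal (𝔟 i) a + 1)) * (r : ℤ)) := by
  open SurfaceRamification in
  have hp := (Fact.out : p.Prime)
  have : IsDomain A := (IsFractionRing.injective A K).isDomain (algebraMap A K)
  have := uniqueFactorizationMonoid hdim
  have : FiniteDimensional K L := Module.finite_of_finrank_pos (hdeg ▸ hp.pos)
  have : CharP K p := charP_of_injective_algebraMap (IsFractionRing.injective A K) p
  have hbr : ∀ i, 𝔟 i ∈ branchPrimes A L := fun i => h𝔟_branch ▸ Set.mem_range_self i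
  choose t ht hbt using fun i => (hbr i).1.exists_eq_span hdim
  obtain rfl : 𝔟 = fun i => Ideal.span {t i} := funext hbt
  beta_reduce at *
  have hdvr : ∀ i, IsDiscreteValuationRing (A ⧸ Ideal.span {t i}) := fun i => by
    have := h𝔟_reg i
    exact isDiscreteValuationRing_of_isRegularLocalRing (hbr i).1.2
  have hT0 : ∏ i, t i ≠ 0 := Finset.prod_ne_zero_iff.2 fun i _ => (ht i).ne_zero
  have hT : ¬ IsUnit (∏ i, t i) := fun hu =>
    (ht ⟨0, hd₁⟩).not_isUnit (IsUnit.prod_univ_iff.1 hu ⟨0, hd₁⟩)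
  have hbrT : ∀ h : A, Prime h → Ideal.span {h} ∈ branchPrimes A L → h ∣ ∏ i, t i := by
    intro h _ hmem
    rw [← h𝔟_branch] at hmem
    obtain ⟨i, hi⟩ := hmem
    exact (Ideal.span_singleton_le_span_singleton.1 hi.le).trans
      (Finset.dvd_prod_of_mem t (Finset.mem_univ i))
  have key : ∀ (x : L) (a : K), IntermediateField.adjoin K {x} = ⊤ →
      x ^ p - x = algebraMap K L a → ∃ m : Fin d → ℕ, (∀ i, 1 ≤ m i) ∧
        (∀ i, -primeVal (Ideal.span {t i}) a = m i) ∧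
        ∀ r : ℕ, 1 ≤ r → IsSufficientOrder L p (fun i => Ideal.span {t i}) r
          (∑ i : Fin d, (m i + 1) * (if (i : ℕ) = 0 then r else 1) - 1) := by
    intro x a hx hxa
    choose m f g hm hg ha hv using fun i =>
      exists_pole_of_mem_branchPrimes hdeg hx hxa (ht i) (hbr i)
    obtain ⟨G, w, hw⟩ := exists_add_pow_sub_mul_prod_eq hd₁ hd₂ ht h𝔟_cross hg ha
      (exists_add_pow_sub_mul_pow_eq hdim hxa hT0 hT hbrT)
    -- The pole orders `m i` are those of the given `a`, while the sufficient order is obtained from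
    -- the modified generator `x + G`, whose denominator has the same exponents.
    exact ⟨m, hm, hv, fun r hr => isSufficientOrder_sum hdim hdeg
      (adjoin_add_algebraMap_eq_top hx G) hd₁ hm (add_algebraMap_pow_sub_mul hxa G hw) hr⟩
  have hsu : ∀ (m : Fin d → ℕ) (r : ℕ), 1 ≤ r →
      IsSufficientOrder L p (fun i => Ideal.span {t i}) r
        (∑ i : Fin d, (m i + 1) * (if (i : ℕ) = 0 then r else 1) - 1) →
      su L p (fun i => Ideal.span {t i}) r + 1 ≤
        ∑ i : Fin d, (m i + 1) * (if (i : ℕ) = 0 then r else 1) ∧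
      su L p (fun i => Ideal.span {t i}) r < (∑ i : Fin d, (m i + 1)) * r := by
    intro m r hr hs
    have h1 : su L p (fun i => Ideal.span {t i}) r ≤ _ := Nat.sInf_le hs
    have h2 : 1 ≤ ∑ i : Fin d, (m i + 1) * (if (i : ℕ) = 0 then r else 1) := by
      have := Finset.single_le_sum (f := fun i : Fin d => (m i + 1) * (if (i : ℕ) = 0 then r else 1))
        (fun i _ => Nat.zero_le _) (Finset.mem_univ (⟨0, hd₁⟩ : Fin d))
      refine le_trans ?_ this
      exact Nat.mul_pos (Nat.succ_pos _) (by simpa using Nat.pos_of_ne_zero (by omega))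
    -- Both possible weights, `r` and `1`, are at most `r`.
    have h3 : ∑ i : Fin d, (m i + 1) * (if (i : ℕ) = 0 then r else 1) ≤
        (∑ i : Fin d, (m i + 1)) * r := by
      rw [Finset.sum_mul]
      refine Finset.sum_le_sum fun i _ => Nat.mul_le_mul_left _ ?_
      split_ifs
      exacts [le_rfl, hr]
    omega
  obtain ⟨x₀, a₀, hx₀, hxa₀⟩ := exists_artinSchreier_generator hdeg
  obtain ⟨m₀, hm₀, -, hs₀⟩ := key x₀ a₀ hx₀ hxa₀
  refine ⟨fun r hr => ⟨_, hs₀ r hr⟩, ⟨∑ i : Fin d, (m₀ i + 1), ?_, fun r hr =>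
    (hsu m₀ r hr (hs₀ r hr)).2⟩, ?_⟩
  · exact (Nat.succ_pos _).trans_le (Finset.single_le_sum (f := fun i => m₀ i + 1)
      (fun i _ => Nat.zero_le _) (Finset.mem_univ ⟨0, hd₁⟩))
  intro x a hx hxa r hr
  obtain ⟨m, -, hv, hs⟩ := key x a hx hxa
  obtain ⟨h1, h2⟩ := hsu m r hr (hs r hr)
  simp only [hv]
  exact ⟨by exact_mod_cast h1, by exact_mod_cast h2⟩
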